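/- Let $n\ge 0$ be an integer, let $p\in\mathbb{R}$ and let $s=\frac{p-1}{2}\in\left(\frac32,2\right)$. Let $H^s=H^s(\mathbb{R}/\mathbb{Z},\mathbb{R}^n)=W^{s,2}(\mathbb{R}/\mathbb{Z},\mathbb{R}^n)$ be the Sobolev–Slobodeckij space of all $\gamma\in L^2(\mathbb{R}/\mathbb{Z},\mathbb{R}^n)$ with a weak derivative $\gamma'\in L^2$ for which $$\|\gamma\|_{H^s}^2=\|\gamma\|_{L^2}^2+\|\gamma'\|_{L^2}^2+\int_{\mathbb{R}/\mathbb{Z}}\int_{\mathbb{R}/\mathbb{Z}}\frac{|\gamma'(x)-\gamma'(y)|^2}{\operatorname{dist}_{\mathbb{R}/\mathbb{Z}}(x,y)^{2s-1}}\,dy\,dx<\infty ,$$ with this norm. Since $s>\frac32$, the elements of $H^s$ are identified with their $C^1$ representatives. Let $H^s_{\mathrm{i,r}}\subset H^s$ be the set of all $\gamma\in H^s$ that are injective on $\mathbb{R}/\mathbb{Z}$ and regular, i.e. $\gamma'(x)\neq 0$ for all $x\in\mathbb{R}/\mathbb{Z}$. For $\gamma\in H^s_{\mathrm{i,r}}$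 let $$\mathrm{TP}^{(p,2)}(\gamma)=\int_{\mathbb{R}/\mathbb{Z}}\int_{\mathbb{R}/\mathbb{Z}}\frac{\left|P^\perp_{\gamma'(x)}\bigl(\gamma(y)-\gamma(x)\bigr)\right|^2}{|\gamma(y)-\gamma(x)|^p}\,|\gamma'(x)|\,|\gamma'(y)|\,dy\,dx$$ be the generalized tangent-point energy, where $P^\perp_{\gamma'(x)}$ is the orthogonal projection of $\mathbb{R}^n$ onto the orthogonal complement of $\mathbb{R}\gamma'(x)$. Then $H^s_{\mathrm{i,r}}$ is an open subset of $H^s$, the energy $\mathrm{TP}^{(p,2)}(\gamma)$ is finite for every $\gamma\in H^s_{\mathrm{i,r}}$, and $\mathrm{TP}^{(p,2)}:H^s_{\mathrm{i,r}}\to\mathbb{R}$ is real analytic, i.e. around every $\gamma_0\in H^s_{\mathrm{i,r}}$ it is given by a power series $\sum_{k\ge0}a_k(\gamma-\gamma_0,\dots,\gamma-\gamma_0)$ with continuous $k$-linear maps $a_k:(H^s)^k\to\mathbb{R}$ and positive radius of convergence. -/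

import Mathlib

open MeasureTheory
open scoped ENNReal ContDiff

namespace TangentPoint

noncomputable section

/-- The circle `ℝ / ℤ`, with its Lebesgue measure and the norm `‖x - y‖ = dist(x, y)`,
the distance of `x - y` to the nearest integer. -/
abbrev Circ : Type := UnitAddCircle

/-- Euclidean `n`-space. -/
abbrev Euc (n : ℕ) : Type := EuclideanSpace ℝ (Fin n)

/-- The Hilbert space `L²(ℝ/ℤ, ℝⁿ)`. -/
abbrev LTwo (n : ℕ) : Type := Lp (Euc n) 2 (volume : Measure Circ)

/-- The Hilbert space `L²(ℝ/ℤ × ℝ/ℤ, ℝⁿ)`. -/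
abbrev LTwoProd (n : ℕ) : Type := Lp (Euc n) 2 (volume : Measure (Circ × Circ))

/-- The classical derivative `c'(x)` of a function on `ℝ/ℤ`. -/
def circDeriv {F : Type*} [NormedAddCommGroup F] [NormedSpace ℝ F] (c : Circ → F) (x : Circ) : F :=
  deriv (fun t : ℝ => c (x + (t : Circ))) 0

/-- `c : ℝ/ℤ → F` is of class `C^k`: its `1`-periodic lift to `ℝ` is. -/
def CircContDiff {F : Type*} [NormedAddCommGroup F] [NormedSpace ℝ F] (k : WithTop ℕ∞)
    (c : Circ → F) : Prop :=
  ContDiff ℝ k (fun t : ℝ => c (t : Circ))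

/-- `v` is the weak derivative of `u` on `ℝ/ℤ`. -/
def IsWeakDeriv {n : ℕ} (u v : LTwo n) : Prop :=
  ∀ φ : Circ → ℝ, CircContDiff ∞ φ →
    ∫ x, circDeriv φ x • u x = - ∫ x, φ x • v x

/-- The fractional difference quotient `(v(x) - v(y)) / dist(x, y)^(σ + 1/2)` of order `σ`. -/
def fracQuot {n : ℕ} (σ : ℝ) (v : Circ → Euc n) (z : Circ × Circ) : Euc n :=
  (‖z.1 - z.2‖ ^ (σ + 1 / 2))⁻¹ • (v z.1 - v z.2)

/-! ### Facts that make the Sobolev-Slobodeckij space a normed space -/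

lemma CircContDiff.continuous' {F : Type*} [NormedAddCommGroup F] [NormedSpace ℝ F]
    {k : WithTop ℕ∞} {c : Circ → F} (h : CircContDiff k c) : Continuous c := by
  have h1 : Continuous (c ∘ (QuotientAddGroup.mk : ℝ → Circ)) := ContDiff.continuous h
  exact continuous_coinduced_dom.2 h1

lemma circDeriv_coe {F : Type*} [NormedAddCommGroup F] [NormedSpace ℝ F] (c : Circ → F) (t : ℝ) :
    circDeriv c (t : Circ) = deriv (fun r : ℝ => c (r : Circ)) t := by
  have h := deriv_comp_const_add (f := fun r : ℝ => c (r : Circ)) t 0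
  simpa [circDeriv] using h

lemma CircContDiff.circDeriv {F : Type*} [NormedAddCommGroup F] [NormedSpace ℝ F]
    {c : Circ → F} (h : CircContDiff ∞ c) : CircContDiff ∞ (circDeriv c) := by
  have h1 : ContDiff ℝ ∞ (deriv (fun t : ℝ => c (t : Circ))) :=
    (contDiff_infty_iff_deriv.1 h).2
  simpa only [CircContDiff, circDeriv_coe] using h1

lemma integrable_smul_of_continuous {R F : Type*} [NormedRing R] [NormedAddCommGroup F] [Module R F]
    [IsBoundedSMul R F] [SecondCountableTopology R] {φ : Circ → R} (hφ : Continuous φ)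
    {f : Circ → F} (hf : Integrable f) : Integrable (fun x => φ x • f x) := by
  obtain ⟨C, hC⟩ := isCompact_univ.exists_bound_of_continuousOn hφ.continuousOn
  exact hf.bdd_smul C hφ.aestronglyMeasurable (ae_of_all _ fun x => hC x (Set.mem_univ x))

lemma integrable_lTwo {n : ℕ} (u : LTwo n) : Integrable (fun x => u x) :=
  (Lp.memLp u).integrable one_le_two

lemma integrable_smul {n : ℕ} {φ : Circ → ℝ} (hφ : Continuous φ) (u : LTwo n) :
    Integrable (fun x => φ x • u x) :=
  integrable_smul_of_continuous hφ (integrable_lTwo u)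

lemma IsWeakDeriv.add {n : ℕ} {u v u' v' : LTwo n} (h : IsWeakDeriv u v)
    (h' : IsWeakDeriv u' v') : IsWeakDeriv (u + u') (v + v') := by
  intro φ hφ
  have e1 : ∫ x, TangentPoint.circDeriv φ x • (u + u' : LTwo n) x
      = ∫ x, (TangentPoint.circDeriv φ x • u x + TangentPoint.circDeriv φ x • u' x) := by
    refine integral_congr_ae ?_
    filter_upwards [Lp.coeFn_add u u'] with x hx
    rw [hx, Pi.add_apply, smul_add]
  have e2 : ∫ x, φ x • (v + v' : LTwo n) x = ∫ x, (φ x • v x + φ x • v' x) := by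
    refine integral_congr_ae ?_
    filter_upwards [Lp.coeFn_add v v'] with x hx
    rw [hx, Pi.add_apply, smul_add]
  rw [e1, e2, integral_add (integrable_smul hφ.circDeriv.continuous' u)
    (integrable_smul hφ.circDeriv.continuous' u'), integral_add
    (integrable_smul hφ.continuous' v) (integrable_smul hφ.continuous' v'), h φ hφ, h' φ hφ]
  abel

lemma IsWeakDeriv.smul {n : ℕ} {u v : LTwo n} (a : ℝ) (h : IsWeakDeriv u v) :
    IsWeakDeriv (a • u) (a • v) := by
  intro φ hφ
  have e1 : ∫ x, TangentPoint.circDeriv φ x • (a • u : LTwo n) x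
      = ∫ x, a • (TangentPoint.circDeriv φ x • u x) := by
    refine integral_congr_ae ?_
    filter_upwards [Lp.coeFn_smul a u] with x hx
    rw [hx, Pi.smul_apply, smul_comm]
  have e2 : ∫ x, φ x • (a • v : LTwo n) x = ∫ x, a • (φ x • v x) := by
    refine integral_congr_ae ?_
    filter_upwards [Lp.coeFn_smul a v] with x hx
    rw [hx, Pi.smul_apply, smul_comm]
  rw [e1, e2, integral_smul, integral_smul, h φ hφ, smul_neg]

lemma circContDiff_fourier (k : ℤ) : CircContDiff ∞ (fun x : Circ => fourier k x) := by
  unfold CircContDiff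
  simp only [fourier_coe_apply]
  have h : ContDiff ℝ ∞ (fun t : ℝ => (t : ℂ)) := Complex.ofRealCLM.contDiff
  fun_prop

lemma eq_zero_of_fourierCoeff {f : Circ → ℝ} (hf : MemLp f 2)
    (h : ∀ φ : Circ → ℝ, CircContDiff ∞ φ → ∫ x, φ x * f x = 0) : f =ᵐ[volume] 0 := by
  have hmem : MemLp (fun x : Circ => (f x : ℂ)) 2 AddCircle.haarAddCircle :=
    memLp_haarAddCircle_iff.2 hf.ofReal
  have hint : Integrable (fun x : Circ => (f x : ℂ)) := (hf.integrable one_le_two).ofReal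
  have hvol : (volume : Measure Circ) = AddCircle.haarAddCircle := by
    rw [AddCircle.volume_eq_smul_haarAddCircle, ENNReal.ofReal_one, one_smul]
  have hcoef : ∀ k : ℤ, fourierCoeff (hmem.toLp _ : Circ → ℂ) k = 0 := by
    intro k
    rw [fourierCoeff_congr_ae hmem.coeFn_toLp, fourierCoeff, ← hvol]
    have hi : Integrable (fun x : Circ => fourier (-k) x * (f x : ℂ)) :=
      integrable_smul_of_continuous (fourier (-k)).continuous hint
    have hR := h (fun x => (fourier (-k) x).re) (Complex.reCLM.contDiff.comp (circContDiff_fourier (-k)))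
    have hI := h (fun x => (fourier (-k) x).im) (Complex.imCLM.contDiff.comp (circContDiff_fourier (-k)))
    have h1 := Complex.reCLM.integral_comp_comm hi
    have h2 := Complex.imCLM.integral_comp_comm hi
    simp only [Complex.reCLM_apply, Complex.imCLM_apply, Complex.re_mul_ofReal,
      Complex.im_mul_ofReal] at h1 h2 hR hI
    apply Complex.ext
    · exact h1.symm.trans hR
    · exact h2.symm.trans hI
  have hz : hmem.toLp _ = 0 := by
    apply (fourierBasis (T := 1)).repr.injective
    ext k
    rw [fourierBasis_repr, hcoef, map_zero]
    rfl
  have h4 := (MemLp.toLp_eq_toLp_iff hmem MemLp.zero).1 (hz.trans (MemLp.toLp_zero _).symm)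
  rw [← hvol] at h4
  filter_upwards [h4] with x hx
  exact Complex.ofReal_eq_zero.1 hx

lemma eq_zero_of_integral_smul_eq_zero {n : ℕ} (v : LTwo n)
    (h : ∀ φ : Circ → ℝ, CircContDiff ∞ φ → ∫ x, φ x • v x = 0) : v = 0 := by
  have key : ∀ i : Fin n, ∀ᵐ x : Circ, v x i = 0 := by
    intro i
    refine eq_zero_of_fourierCoeff ((EuclideanSpace.proj (𝕜 := ℝ) i).comp_memLp v) ?_
    intro φ hφ
    have h1 := congrArg (EuclideanSpace.proj (𝕜 := ℝ) i) (h φ hφ)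
    rw [← ContinuousLinearMap.integral_comp_comm _ (integrable_smul hφ.continuous' v)] at h1
    exact h1
  rw [Lp.eq_zero_iff_ae_eq_zero]
  filter_upwards [ae_all_iff.2 key] with x hx
  ext i
  exact hx i

lemma IsWeakDeriv.unique {n : ℕ} {u v v' : LTwo n} (h : IsWeakDeriv u v)
    (h' : IsWeakDeriv u v') : v = v' := by
  have h0 : IsWeakDeriv (u + (-1 : ℝ) • u) (v + (-1 : ℝ) • v') := h.add (h'.smul (-1))
  have hu : u + (-1 : ℝ) • u = 0 := by simp
  rw [hu] at h0
  have : v + (-1 : ℝ) • v' = 0 := by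
    refine eq_zero_of_integral_smul_eq_zero _ fun φ hφ => ?_
    have h1 := h0 φ hφ
    have h2 : ∫ x, TangentPoint.circDeriv φ x • (0 : LTwo n) x = 0 := by
      rw [← integral_zero Circ (Euc n)]
      refine integral_congr_ae ?_
      filter_upwards [Lp.coeFn_zero (Euc n) 2 (volume : Measure Circ)] with x hx
      rw [hx, Pi.zero_apply, smul_zero]
    rw [h2] at h1
    exact neg_eq_zero.1 h1.symm
  simpa [← sub_eq_add_neg, sub_eq_zero] using this

lemma fracQuot_add_ae {n : ℕ} (σ : ℝ) (v w : LTwo n) :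
    fracQuot σ (v + w : LTwo n) =ᵐ[volume] fracQuot σ v + fracQuot σ w := by
  have h := Lp.coeFn_add v w
  filter_upwards [Measure.quasiMeasurePreserving_fst.ae h,
    Measure.quasiMeasurePreserving_snd.ae h] with z h1 h2
  simp only [fracQuot, Pi.add_apply, h1, h2, ← smul_add]
  congr 1
  abel

lemma fracQuot_smul_ae {n : ℕ} (σ a : ℝ) (v : LTwo n) :
    fracQuot σ (a • v : LTwo n) =ᵐ[volume] a • fracQuot σ v := by
  have h := Lp.coeFn_smul a v
  filter_upwards [Measure.quasiMeasurePreserving_fst.ae h,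
    Measure.quasiMeasurePreserving_snd.ae h] with z h1 h2
  simp only [fracQuot, Pi.smul_apply, h1, h2, ← smul_sub]
  rw [smul_comm]

lemma fracQuot_zero_ae {n : ℕ} (σ : ℝ) :
    fracQuot σ (0 : LTwo n) =ᵐ[volume] (0 : Circ × Circ → Euc n) := by
  have h := fracQuot_smul_ae σ 0 (0 : LTwo n)
  simpa using h

/-! ### The Sobolev-Slobodeckij space `H^s(ℝ/ℤ, ℝⁿ)`, `1 < s < 2` -/

/-- For `1 < s < 2`, the subspace `H^s = W^{s,2}` of `L²(ℝ/ℤ, ℝⁿ)`: all `u` with a weak derivative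
`u' ∈ L²` whose Gagliardo seminorm
`[u']²_{s-1} = ∬ |u'(x) - u'(y)|² / dist(x, y)^(1 + 2 (s - 1)) dx dy` is finite. -/
def sobolevSubmodule (s : ℝ) (n : ℕ) : Submodule ℝ (LTwo n) where
  carrier := {u | ∃ v : LTwo n, IsWeakDeriv u v ∧ MemLp (fracQuot (s - 1) v) 2 volume}
  add_mem' := by
    rintro u u' ⟨v, hv, hm⟩ ⟨v', hv', hm'⟩
    exact ⟨v + v', hv.add hv', (memLp_congr_ae (fracQuot_add_ae _ v v')).2 (hm.add hm')⟩
  zero_mem' := by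
    refine ⟨0, ?_, (memLp_congr_ae (fracQuot_zero_ae _)).2 MemLp.zero⟩
    intro φ hφ
    have h : ∀ ψ : Circ → ℝ, ∫ x, ψ x • (0 : LTwo n) x = 0 := by
      intro ψ
      rw [← integral_zero Circ (Euc n)]
      refine integral_congr_ae ?_
      filter_upwards [Lp.coeFn_zero (Euc n) 2 (volume : Measure Circ)] with x hx
      rw [hx, Pi.zero_apply, smul_zero]
    rw [h, h, neg_zero]
  smul_mem' := by
    rintro a u ⟨v, hv, hm⟩
    exact ⟨a • v, hv.smul a, (memLp_congr_ae (fracQuot_smul_ae _ a v)).2 (hm.const_smul a)⟩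

/-- The space `H^s(ℝ/ℤ, ℝⁿ)`, `1 < s < 2`. It is a type of its own, so that it carries the
`H^s`-norm below and not the `L²`-norm. -/
def Sobolev (s : ℝ) (n : ℕ) : Type := sobolevSubmodule s n

instance (s : ℝ) (n : ℕ) : AddCommGroup (Sobolev s n) :=
  inferInstanceAs (AddCommGroup (sobolevSubmodule s n))

instance (s : ℝ) (n : ℕ) : Module ℝ (Sobolev s n) :=
  inferInstanceAs (Module ℝ (sobolevSubmodule s n))

namespace Sobolev

variable {s : ℝ} {n : ℕ}

/-- The inclusion `H^s → L²`. -/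
def toL2 : Sobolev s n →ₗ[ℝ] LTwo n := (sobolevSubmodule s n).subtype

lemma exists_weakDeriv (γ : Sobolev s n) :
    ∃ v : LTwo n, IsWeakDeriv γ.toL2 v ∧ MemLp (fracQuot (s - 1) v) 2 volume :=
  Subtype.prop (p := fun u => u ∈ sobolevSubmodule s n) γ

/-- The weak derivative `γ' ∈ L²` of `γ ∈ H^s`. -/
def weakDeriv (γ : Sobolev s n) : LTwo n := γ.exists_weakDeriv.choose

lemma isWeakDeriv (γ : Sobolev s n) : IsWeakDeriv γ.toL2 γ.weakDeriv :=
  γ.exists_weakDeriv.choose_spec.1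

lemma memLp_fracQuot (γ : Sobolev s n) : MemLp (fracQuot (s - 1) γ.weakDeriv) 2 volume :=
  γ.exists_weakDeriv.choose_spec.2

lemma weakDeriv_add (γ η : Sobolev s n) : (γ + η).weakDeriv = γ.weakDeriv + η.weakDeriv := by
  refine (γ + η).isWeakDeriv.unique ?_
  rw [map_add]
  exact γ.isWeakDeriv.add η.isWeakDeriv

lemma weakDeriv_smul (a : ℝ) (γ : Sobolev s n) : (a • γ).weakDeriv = a • γ.weakDeriv := by
  refine (a • γ).isWeakDeriv.unique ?_
  rw [map_smul]
  exact γ.isWeakDeriv.smul a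

/-- The linear map `γ ↦ (γ, γ', (γ'(x) - γ'(y)) / dist(x, y)^(s - 1/2))` into the Hilbert space
`L²(ℝ/ℤ) × L²(ℝ/ℤ) × L²(ℝ/ℤ × ℝ/ℤ)`. -/
def graphMap : Sobolev s n →ₗ[ℝ] WithLp 2 (LTwo n × WithLp 2 (LTwo n × LTwoProd n)) where
  toFun γ := WithLp.toLp 2 (γ.toL2, WithLp.toLp 2 (γ.weakDeriv, γ.memLp_fracQuot.toLp _))
  map_add' γ η := by
    have h : (γ + η).memLp_fracQuot.toLp _
        = γ.memLp_fracQuot.toLp _ + η.memLp_fracQuot.toLp _ := by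
      rw [← MemLp.toLp_add]
      refine MemLp.toLp_congr _ _ ?_
      rw [weakDeriv_add]
      exact fracQuot_add_ae _ _ _
    rw [h, weakDeriv_add, map_add]
    rfl
  map_smul' a γ := by
    have h : (a • γ).memLp_fracQuot.toLp _ = a • γ.memLp_fracQuot.toLp _ := by
      rw [← MemLp.toLp_const_smul]
      refine MemLp.toLp_congr _ _ ?_
      rw [weakDeriv_smul]
      exact fracQuot_smul_ae _ _ _
    rw [h, weakDeriv_smul, map_smul]
    rfl

lemma graphMap_injective : Function.Injective (graphMap : Sobolev s n →ₗ[ℝ] _) := by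
  intro γ η h
  have h1 : γ.toL2 = η.toL2 := congrArg WithLp.fst h
  exact Subtype.val_injective h1

/-- The Sobolev-Slobodeckij norm
`‖γ‖²_{H^s} = ‖γ‖²_{L²} + ‖γ'‖²_{L²} + [γ']²_{s-1}` (see `Sobolev.norm_sq`). -/
instance : NormedAddCommGroup (Sobolev s n) :=
  NormedAddCommGroup.induced _ _ (graphMap : Sobolev s n →ₗ[ℝ] _) graphMap_injective

instance : NormedSpace ℝ (Sobolev s n) :=
  NormedSpace.induced ℝ (Sobolev s n) _ (graphMap : Sobolev s n →ₗ[ℝ] _)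

lemma norm_sq (γ : Sobolev s n) :
    ‖γ‖ ^ 2 = ‖γ.toL2‖ ^ 2 + (‖γ.weakDeriv‖ ^ 2 + ‖γ.memLp_fracQuot.toLp _‖ ^ 2) := by
  have h : ‖γ‖ = ‖graphMap γ‖ := rfl
  rw [h, WithLp.prod_norm_sq_eq_of_L2, WithLp.prod_norm_sq_eq_of_L2]
  rfl

/-- `γ ∈ H^s` is injective and regular: its `C¹` representative `c` (for `s > 3/2` every element of
`H^s` has exactly one) is injective and satisfies `c'(x) ≠ 0` for all `x`. -/
def IsInjectiveRegular (γ : Sobolev s n) : Prop :=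
  ∃ c : Circ → Euc n, CircContDiff 1 c ∧ γ.toL2 =ᵐ[volume] c ∧
    Function.Injective c ∧ ∀ x, circDeriv c x ≠ 0

/-- The set `H^s_{i,r}(ℝ/ℤ, ℝⁿ)` of injective regular `H^s`-curves. -/
def injectiveRegular (s : ℝ) (n : ℕ) : Set (Sobolev s n) := {γ | γ.IsInjectiveRegular}

end Sobolev

/-! ### The generalized tangent-point energies -/

/-- The orthogonal projection of `v` onto the orthogonal complement of the line `ℝ τ`. -/
def normalProj {n : ℕ} (τ v : Euc n) : Euc n := (ℝ ∙ τ)ᗮ.starProjection v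

/-- The generalized tangent-point energy
`∫∫ |P^⊥_{c'(x)} (c(y) - c(x))|^q / |c(y) - c(x)|^p |c'(x)| |c'(y)| dy dx ∈ [0, ∞]`
of a curve `c` with derivative `c'`. It does not change when `c` and `c'` are changed on
null sets. -/
def tangentPointEnergy {n : ℕ} (p q : ℝ) (c c' : Circ → Euc n) : ℝ≥0∞ :=
  ∫⁻ x, ∫⁻ y, ENNReal.ofReal
    (‖normalProj (c' x) (c y - c x)‖ ^ q / ‖c y - c x‖ ^ p * ‖c' x‖ * ‖c' y‖)

/-- The energy `TP^(p,q)` on `H^s`. The weak derivative of an injective regular `γ` is almost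
everywhere the classical derivative of its `C¹` representative. -/
def Sobolev.energy {s : ℝ} {n : ℕ} (p q : ℝ) (γ : Sobolev s n) : ℝ≥0∞ :=
  tangentPointEnergy p q γ.toL2 γ.weakDeriv

end

end TangentPoint

/-!
The energy is an analytic expression in quantities that depend linearly and boundedly on the curve.

For `s > 3/2` the derivative of `γ ∈ H^s` has a continuous representative `V`, bounded by the norm
of `γ` (`exists_continuous_representative`, `Sobolev.contDeriv`). A pair of points of the circle is
written as `(x, x + h)` with `h ∈ [-1/2, 1/2]`, so that `(x, h)` ranges over a compact space. On it
the difference quotient `Q(x, h) = (γ(x + h) - γ(x)) / h = ∫₀¹ V(x + θ h) dθ` is continuous up to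
`h = 0`, where it equals `γ'(x)` (`Sobolev.diffQuot`). Thus `γ` is injective and regular if and only
if `Q` vanishes nowhere (`Sobolev.isInjectiveRegular_iff`), an open condition in the uniform norm.

The normal projection at `x` annihilates `γ'(x)`, so in the numerator of the energy `γ(y) - γ(x)` may
be replaced by `γ(y) - γ(x) - h γ'(x)`. Since `p = 2 s + 1`, the integrand becomes
`(|T|² - ⟨γ'(x), T⟩² / |γ'(x)|²) |Q|^(-p) |γ'(x)| |γ'(y)|` with the remainder
`T = (γ(y) - γ(x) - h γ'(x)) / |h|^(s + 1/2)` (`Sobolev.energy_integrand_eq`). A Hardy inequality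
(`eLpNorm_taylorQuot_le`) shows that `γ ↦ T` is bounded from `H^s` to `L²` of the torus, so the
energy is a difference of two weighted square integrals of `L²`-functions that are polynomial in
`γ`. The weights are products of real powers of norms of nowhere vanishing continuous functions, and
these are analytic maps into the Banach algebra of continuous functions by the binomial series
(`exists_analyticAt_rpow`).
-/

namespace TangentPoint

open Filter Topology

noncomputable section

/-! ### Morrey's embedding -/

section Morrey

variable {n : ℕ}

lemma norm_sub_le_fracQuot {σ d : ℝ} (hσ : 0 ≤ σ + 1 / 2) (v : Circ → Euc n) {z : Circ × Circ}
    (hz : ‖z.1 - z.2‖ ≤ d) : ‖v z.1 - v z.2‖ ≤ d ^ (σ + 1 / 2) * ‖fracQuot σ v z‖ := by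
  rcases eq_or_ne z.1 z.2 with h | h
  · rw [h, sub_self, norm_zero]
    have : 0 ≤ d := (norm_nonneg _).trans hz
    positivity
  · have h0 : 0 < ‖z.1 - z.2‖ := norm_pos_iff.2 (sub_ne_zero.2 h)
    have h1 : 0 < ‖z.1 - z.2‖ ^ (σ + 1 / 2) := Real.rpow_pos_of_pos h0 _
    have h2 : ‖v z.1 - v z.2‖ = ‖z.1 - z.2‖ ^ (σ + 1 / 2) * ‖fracQuot σ v z‖ := by
      rw [fracQuot, norm_smul, norm_inv, Real.norm_of_nonneg h1.le, mul_inv_cancel_left₀ h1.ne']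
    rw [h2]
    gcongr

/-- Two averages of `v` differ by the mean of `v(a) - v(b)` over `A × B`, which the Cauchy-Schwarz
inequality bounds by the Gagliardo seminorm when `A` and `B` lie within distance `d`. -/
lemma norm_average_sub_average_le {σ d : ℝ} (hσ : 0 ≤ σ + 1 / 2) {v : Circ → Euc n}
    (hv : Integrable v) (hg : MemLp (fracQuot σ v) 2 volume) {A B : Set Circ}
    (hA : volume.real A ≠ 0) (hB : volume.real B ≠ 0) (hAm : MeasurableSet A)
    (hBm : MeasurableSet B) (hd0 : 0 ≤ d)
    (hd : ∀ a ∈ A, ∀ b ∈ B, ‖a - b‖ ≤ d) :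
    ‖(⨍ x in A, v x) - ⨍ x in B, v x‖ ≤ (√(volume.real A * volume.real B))⁻¹ *
      (d ^ (σ + 1 / 2) * (eLpNorm (fracQuot σ v) 2 volume).toReal) := by
  set μ := volume.restrict A
  set ν := volume.restrict B
  set N := (eLpNorm (fracQuot σ v) 2 volume).toReal
  set a := volume.real A
  set b := volume.real B
  have ha : 0 < a := lt_of_le_of_ne measureReal_nonneg hA.symm
  have hb : 0 < b := lt_of_le_of_ne measureReal_nonneg hB.symm
  have hprod : μ.prod ν = (volume : Measure (Circ × Circ)).restrict (A ×ˢ B) :=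
    Measure.prod_restrict _ _
  have hvμ : Integrable v μ := hv.restrict
  have hvν : Integrable v ν := hv.restrict
  have huniv : (μ.prod ν).real Set.univ = a * b := by
    rw [← Set.univ_prod_univ, measureReal_prod_prod]
    simp [μ, ν, a, b, measureReal_def]
  have e1 : ∫ z, (v z.1 - v z.2) ∂(μ.prod ν) = b • (∫ x in A, v x) - a • ∫ x in B, v x := by
    rw [integral_sub (hvμ.comp_fst ν) (hvν.comp_snd μ), integral_fun_fst, integral_fun_snd]
    simp [μ, ν, a, b, measureReal_def]
  have e2 : (⨍ x in A, v x) - ⨍ x in B, v x = (a * b)⁻¹ • ∫ z, (v z.1 - v z.2) ∂(μ.prod ν) := by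
    rw [e1, setAverage_eq, setAverage_eq, smul_sub, smul_smul, smul_smul]
    congr 2
    · field_simp; exact div_self ha.ne'
    · field_simp; exact div_self hb.ne'
  have hg' : MemLp (fracQuot σ v) 2 (μ.prod ν) := by rw [hprod]; exact hg.restrict _
  have hgi : Integrable (fracQuot σ v) (μ.prod ν) := hg'.integrable one_le_two
  have e3 : ‖∫ z, (v z.1 - v z.2) ∂(μ.prod ν)‖
      ≤ d ^ (σ + 1 / 2) * ∫ z, ‖fracQuot σ v z‖ ∂(μ.prod ν) := by
    rw [← integral_const_mul]
    refine norm_integral_le_of_norm_le (hgi.norm.const_mul _) ?_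
    rw [hprod]
    filter_upwards [ae_restrict_mem (hAm.prod hBm)] with z hz
    exact norm_sub_le_fracQuot hσ v (hd _ hz.1 _ hz.2)
  have e4 : ∫ z, ‖fracQuot σ v z‖ ∂(μ.prod ν) ≤ N * √(a * b) := by
    have h1 := eLpNorm_le_eLpNorm_mul_rpow_measure_univ (p := 1) (q := 2) one_le_two hg'.1
    rw [integral_norm_eq_lintegral_enorm hg'.1, ← eLpNorm_one_eq_lintegral_enorm]
    have h2 : eLpNorm (fracQuot σ v) 2 (μ.prod ν) ≤ eLpNorm (fracQuot σ v) 2 volume := by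
      rw [hprod]; exact eLpNorm_restrict_le _ _ _ _
    have h3 := ENNReal.toReal_mono (ENNReal.mul_ne_top hg.2.ne
      (ENNReal.rpow_ne_top_of_nonneg (by norm_num) (measure_ne_top _ _))) (h1.trans (mul_le_mul_left h2 _))
    refine h3.trans (le_of_eq ?_)
    rw [ENNReal.toReal_mul, ← ENNReal.toReal_rpow, ← measureReal_def, huniv, Real.sqrt_eq_rpow]
    norm_num [N]
  have hab : 0 < a * b := mul_pos ha hb
  rw [e2, norm_smul, norm_inv, Real.norm_of_nonneg hab.le]
  calc (a * b)⁻¹ * _ ≤ (a * b)⁻¹ * (d ^ (σ + 1 / 2) * (N * √(a * b))) := by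
        gcongr
        exact e3.trans (by gcongr)
    _ = _ := by
        have h5 : √(a * b) ≠ 0 := (Real.sqrt_pos.2 hab).ne'
        have h6 : a * b = √(a * b) * √(a * b) := (Real.mul_self_sqrt hab.le).symm
        rw [h6]
        simp only [Real.sqrt_mul_self (Real.sqrt_nonneg _)]
        field_simp

lemma le_volume_closedBall (x : Circ) {r : ℝ} (h0 : 0 ≤ r) (h1 : r ≤ 1) :
    r ≤ volume.real (Metric.closedBall x r) := by
  rw [measureReal_def, AddCircle.volume_closedBall, ENNReal.toReal_ofReal]
  · exact le_min h1 (by linarith)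
  · exact le_min zero_le_one (by linarith)

/-- Comparison of averages over balls of comparable radii whose centres are at most a radius apart.
All points involved lie within distance `3 ρ` of each other. -/
lemma norm_ballAverage_sub_le {σ ρ r : ℝ} (hσ : 0 ≤ σ + 1 / 2) {v : Circ → Euc n}
    (hv : Integrable v) (hg : MemLp (fracQuot σ v) 2 volume) (hρ : 0 < ρ) (hρ1 : ρ ≤ 1)
    (hr : ρ / 2 ≤ r) (hr1 : r ≤ ρ) {x y : Circ} (hxy : dist x y ≤ ρ) :
    ‖(⨍ t in Metric.closedBall x ρ, v t) - ⨍ t in Metric.closedBall y r, v t‖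
      ≤ 2 * 3 ^ (σ + 1 / 2) * (eLpNorm (fracQuot σ v) 2 volume).toReal * ρ ^ (σ - 1 / 2) := by
  have hA := le_volume_closedBall x hρ.le hρ1
  have hB := le_volume_closedBall y (by linarith : 0 ≤ r) (hr1.trans hρ1)
  set N := (eLpNorm (fracQuot σ v) 2 volume).toReal
  have hN : 0 ≤ N := ENNReal.toReal_nonneg
  refine (norm_average_sub_average_le (d := 3 * ρ) hσ hv hg (by linarith) (by linarith)
    measurableSet_closedBall measurableSet_closedBall (by positivity) ?_).trans ?_
  · intro a ha b hb
    rw [← dist_eq_norm]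
    have := dist_triangle4 a x y b
    rw [Metric.mem_closedBall] at ha hb
    rw [dist_comm y b] at this
    linarith
  · have h1 : ρ / 2 ≤ √(volume.real (Metric.closedBall x ρ) * volume.real (Metric.closedBall y r)) := by
      refine Real.le_sqrt_of_sq_le ?_
      nlinarith
    calc _ ≤ (ρ / 2)⁻¹ * ((3 * ρ) ^ (σ + 1 / 2) * N) := by gcongr
      _ = _ := by
        rw [Real.mul_rpow (by norm_num) hρ.le, show σ + 1 / 2 = (σ - 1 / 2) + 1 by ring,
          Real.rpow_add hρ _ 1, Real.rpow_one]
        field_simp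

/-- **Morrey's embedding** for the Slobodeckij space of order `σ > 1/2`: an `L²`-function with
finite Gagliardo seminorm has a continuous representative, with a bound on its supremum. The
representative is the limit of the averages over balls of radius `2⁻ᵏ`, whose consecutive
differences decay like `2^(-k (σ - 1/2))`. -/
lemma exists_continuous_representative {σ : ℝ} (hσ : 1 / 2 < σ) (n : ℕ) :
    ∃ C : ℝ, 0 ≤ C ∧ ∀ v : LTwo n, MemLp (fracQuot σ v) 2 volume →
      ∃ V : C(Circ, Euc n), v =ᵐ[volume] V ∧
        ‖V‖ ≤ ‖v‖ + C * (eLpNorm (fracQuot σ v) 2 volume).toReal := by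
  set q : ℝ := (1 / 2 : ℝ) ^ (σ - 1 / 2) with hq
  have hq0 : 0 < q := Real.rpow_pos_of_pos (by norm_num) _
  have hq1 : q < 1 := Real.rpow_lt_one (by norm_num) (by norm_num) (by linarith)
  set C₀ : ℝ := 2 * 3 ^ (σ + 1 / 2) with hC₀
  have hC₀0 : 0 ≤ C₀ := by positivity
  refine ⟨C₀ / (1 - q), div_nonneg hC₀0 (by linarith), fun v hg => ?_⟩
  set N := (eLpNorm (fracQuot σ v) 2 volume).toReal
  have hN : 0 ≤ N := ENNReal.toReal_nonneg
  have hv : Integrable (fun x => v x) := integrable_lTwo v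
  set avg : ℕ → Circ → Euc n := fun k x => ⨍ t in Metric.closedBall x ((1 / 2) ^ k), v t
  have hpow : ∀ k : ℕ, ((1 / 2 : ℝ) ^ k) ^ (σ - 1 / 2) = q ^ k := fun k => by
    rw [hq, ← Real.rpow_natCast, ← Real.rpow_natCast, ← Real.rpow_mul (by norm_num),
      ← Real.rpow_mul (by norm_num), mul_comm]
  have hpos : ∀ k : ℕ, (0 : ℝ) < (1 / 2) ^ k := fun k => by positivity
  have hle : ∀ k : ℕ, (1 / 2 : ℝ) ^ k ≤ 1 := fun k => pow_le_one₀ (by norm_num) (by norm_num)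
  have hstep : ∀ x k, dist (avg k x) (avg (k + 1) x) ≤ C₀ * N * q ^ k := fun x k => by
    rw [dist_eq_norm, ← hpow]
    refine norm_ballAverage_sub_le (by linarith) hv hg (hpos k) (hle k) ?_ ?_ ?_
    · rw [pow_succ]; linarith
    · rw [pow_succ]; linarith [hpos k]
    · rw [dist_self]; exact (hpos k).le
  have hlim : ∀ x, ∃ l, Tendsto (fun k => avg k x) atTop (𝓝 l) := fun x =>
    cauchySeq_tendsto_of_complete (cauchySeq_of_le_geometric q _ hq1 (hstep x))
  choose V hV using hlim
  have htail : ∀ x k, dist (avg k x) (V x) ≤ C₀ * N * q ^ k / (1 - q) := fun x k =>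
    dist_le_of_le_geometric_of_tendsto q _ hq1 (hstep x) (hV x) k
  have hcont : Continuous V := by
    rw [Metric.continuous_iff]
    intro x ε hε
    have h0 : Tendsto (fun k : ℕ => 2 * (C₀ * N * q ^ k / (1 - q)) + C₀ * N * q ^ k) atTop (𝓝 0) := by
      have := tendsto_pow_atTop_nhds_zero_of_lt_one hq0.le hq1
      have h := (((this.const_mul (C₀ * N)).div_const (1 - q)).const_mul 2).add
        (this.const_mul (C₀ * N))
      simpa using h
    obtain ⟨k, hk⟩ := ((tendsto_order.1 h0).2 ε hε).exists
    refine ⟨(1 / 2) ^ k, hpos k, fun y hy => ?_⟩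
    have h1 : dist (avg k y) (avg k x) ≤ C₀ * N * q ^ k := by
      rw [dist_eq_norm, ← hpow]
      exact norm_ballAverage_sub_le (by linarith) hv hg (hpos k) (hle k)
        (by linarith [hpos k]) le_rfl hy.le
    have h2 := dist_triangle4 (V y) (avg k y) (avg k x) (V x)
    have h3 := htail y k
    rw [dist_comm] at h3
    linarith [htail x k]
  refine ⟨⟨V, hcont⟩, ?_, ?_⟩
  · filter_upwards [IsUnifLocDoublingMeasure.ae_tendsto_average volume
      hv.locallyIntegrable 1] with x hx
    refine tendsto_nhds_unique (hx (fun _ => x) (fun k : ℕ => (1 / 2) ^ k) ?_ ?_) (hV x)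
    · refine tendsto_nhdsWithin_iff.2 ⟨?_, Eventually.of_forall hpos⟩
      exact tendsto_pow_atTop_nhds_zero_of_lt_one (by norm_num) (by norm_num)
    · exact Eventually.of_forall fun k => Metric.mem_closedBall_self (by linarith [hpos k])
  · refine (ContinuousMap.norm_le _ (by positivity [sub_pos.2 hq1])).2 fun x => ?_
    -- the ball of radius `2⁰` is the whole circle, so the first average is the mean of `v`
    have h1 : avg 0 x = ∫ t, v t := by
      have hu : Metric.closedBall x ((1 / 2 : ℝ) ^ 0) = Set.univ :=
        AddCircle.closedBall_eq_univ_of_half_period_le _ one_ne_zero x (by norm_num)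
      simp only [avg]
      rw [hu, setAverage_eq, Measure.restrict_univ, measureReal_def, UnitAddCircle.measure_univ]
      simp
    have h2 : ‖∫ t, v t‖ ≤ ‖v‖ := by
      refine (norm_integral_le_integral_norm _).trans ?_
      rw [integral_norm_eq_lintegral_enorm (Lp.aestronglyMeasurable v),
        ← eLpNorm_one_eq_lintegral_enorm, Lp.norm_def]
      refine ENNReal.toReal_mono (Lp.eLpNorm_ne_top v) ?_
      have := eLpNorm_le_eLpNorm_mul_rpow_measure_univ (p := 1) (q := 2) one_le_two
        (Lp.aestronglyMeasurable v)
      simpa using this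
    have h3 := htail x 0
    rw [dist_eq_norm, h1, pow_zero, mul_one] at h3
    have h4 : ‖V x‖ ≤ ‖∫ t, v t‖ + ‖(∫ t, v t) - V x‖ := by
      have := norm_sub_le (∫ t, v t) ((∫ t, v t) - V x)
      rwa [sub_sub_cancel] at this
    calc ‖V x‖ ≤ ‖v‖ + C₀ * N / (1 - q) := by linarith
      _ = _ := by ring

end Morrey

/-! ### Weak and classical derivatives -/

section Primitive

variable {F : Type*} [NormedAddCommGroup F] [NormedSpace ℝ F]

lemma continuous_coe_circ : Continuous (fun t : ℝ => (t : Circ)) := AddCircle.continuous_mk' 1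

/-- A continuous function of mean zero on the circle has a primitive on the circle. -/
lemma exists_primitive [CompleteSpace F] {f : Circ → F} (hf : Continuous f) (h0 : ∫ x, f x = 0) :
    ∃ c : Circ → F, ∀ t : ℝ, HasDerivAt (fun r : ℝ => c (r : Circ)) (f (t : Circ)) t := by
  have hc : Continuous (fun t : ℝ => f (t : Circ)) := hf.comp continuous_coe_circ
  have hper : Function.Periodic (fun t : ℝ => ∫ r in (0 : ℝ)..t, f (r : Circ)) 1 := by
    intro t
    have h1 := intervalIntegral.integral_add_adjacent_intervals
      (hc.intervalIntegrable (μ := volume) 0 t) (hc.intervalIntegrable t (t + 1))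
    have h2 := UnitAddCircle.intervalIntegral_preimage t f
    rw [h2, h0, add_zero] at h1
    exact h1.symm
  refine ⟨hper.lift, fun t => ?_⟩
  have := intervalIntegral.integral_hasDerivAt_right (hc.intervalIntegrable (μ := volume) 0 t)
    hc.stronglyMeasurable.stronglyMeasurableAtFilter hc.continuousAt
  exact this

lemma circDeriv_eq_of_hasDerivAt {c f : Circ → F}
    (h : ∀ t : ℝ, HasDerivAt (fun r : ℝ => c (r : Circ)) (f (t : Circ)) t) : circDeriv c = f := by
  funext x
  obtain ⟨t, rfl⟩ := QuotientAddGroup.mk_surjective x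
  exact (circDeriv_coe c t).trans (h t).deriv

lemma circContDiff_one_of_hasDerivAt {c f : Circ → F} (hf : Continuous f)
    (h : ∀ t : ℝ, HasDerivAt (fun r : ℝ => c (r : Circ)) (f (t : Circ)) t) :
    CircContDiff 1 c := by
  rw [CircContDiff, contDiff_one_iff_deriv]
  refine ⟨fun t => (h t).differentiableAt, ?_⟩
  rw [show deriv (fun t : ℝ => c (t : Circ)) = fun t : ℝ => f (t : Circ) from
    funext fun t => (h t).deriv]
  exact hf.comp continuous_coe_circ

lemma circContDiff_infty_of_hasDerivAt {c f : Circ → F} (hf : CircContDiff ∞ f)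
    (h : ∀ t : ℝ, HasDerivAt (fun r : ℝ => c (r : Circ)) (f (t : Circ)) t) :
    CircContDiff ∞ c := by
  rw [CircContDiff, contDiff_infty_iff_deriv]
  refine ⟨fun t => (h t).differentiableAt, ?_⟩
  rw [show deriv (fun t : ℝ => c (t : Circ)) = fun t : ℝ => f (t : Circ) from
    funext fun t => (h t).deriv]
  exact hf

lemma CircContDiff.hasDerivAt {φ : Circ → F} (hφ : CircContDiff ∞ φ) (t : ℝ) :
    HasDerivAt (fun r : ℝ => φ (r : Circ)) (TangentPoint.circDeriv φ (t : Circ)) t := by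
  rw [circDeriv_coe]
  exact ((contDiff_infty_iff_deriv.1 hφ).1 t).hasDerivAt

/-- Integration by parts on the circle. -/
lemma integral_circDeriv_smul [CompleteSpace F] {φ : Circ → ℝ} (hφ : CircContDiff ∞ φ)
    {c f : Circ → F} (hf : Continuous f)
    (h : ∀ t : ℝ, HasDerivAt (fun r : ℝ => c (r : Circ)) (f (t : Circ)) t) :
    ∫ x, circDeriv φ x • c x = -∫ x, φ x • f x := by
  have hcc : Continuous c := (circContDiff_one_of_hasDerivAt hf h).continuous'
  have h1 : Continuous (fun x => φ x • f x) := hφ.continuous'.smul hf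
  have h2 : Continuous (fun x => circDeriv φ x • c x) := hφ.circDeriv.continuous'.smul hcc
  have hd : ∀ t : ℝ, HasDerivAt (fun r : ℝ => φ (r : Circ) • c (r : Circ))
      (φ (t : Circ) • f (t : Circ) + circDeriv φ (t : Circ) • c (t : Circ)) t :=
    fun t => (hφ.hasDerivAt t).smul (h t)
  have h3 := intervalIntegral.integral_eq_sub_of_hasDerivAt (a := 0) (b := 0 + 1)
    (fun t _ => hd t) (((h1.add h2).comp continuous_coe_circ).intervalIntegrable _ _)
  have h4 := UnitAddCircle.intervalIntegral_preimage 0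
    (fun x : Circ => φ x • f x + circDeriv φ x • c x)
  have hz : ((0 + 1 : ℝ) : Circ) = ((0 : ℝ) : Circ) := by
    rw [zero_add]; exact AddCircle.coe_period 1
  rw [h3, hz, sub_self, integral_add (h1.integrable_of_hasCompactSupport (.of_compactSpace _))
    (h2.integrable_of_hasCompactSupport (.of_compactSpace _))] at h4
  exact eq_neg_of_add_eq_zero_right h4.symm

end Primitive

section WeakDerivative

variable {n : ℕ}

lemma CircContDiff.const (a : ℝ) : CircContDiff ∞ (fun _ : Circ => a) := contDiff_const

lemma circDeriv_const (a : ℝ) : circDeriv (fun _ : Circ => a) = fun _ => 0 := by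
  funext x; simp [circDeriv]

/-- A weak derivative has mean zero. -/
lemma IsWeakDeriv.integral_eq_zero {u v : LTwo n} (h : IsWeakDeriv u v) : ∫ x, v x = 0 := by
  have := h (fun _ => 1) (.const 1)
  simpa [circDeriv_const] using this.symm

/-- A function on the circle whose weak derivative vanishes is constant. -/
lemma ae_eq_const_of_weakDeriv_zero (u : LTwo n)
    (h : ∀ φ : Circ → ℝ, CircContDiff ∞ φ → ∫ x, circDeriv φ x • u x = 0) :
    u =ᵐ[volume] fun _ => ∫ x, u x := by
  set m := ∫ x, u x
  have hconst : MemLp (fun _ : Circ => m) 2 volume := memLp_const m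
  have key : u - hconst.toLp _ = 0 := by
    refine eq_zero_of_integral_smul_eq_zero _ fun ψ hψ => ?_
    have hψi : Integrable ψ := hψ.continuous'.integrable_of_hasCompactSupport (.of_compactSpace _)
    -- `ψ` minus its mean is the derivative of a test function
    obtain ⟨φ, hφ⟩ := exists_primitive (f := fun x => ψ x - ∫ y, ψ y)
      (hψ.continuous'.sub continuous_const) (by
        rw [integral_sub hψi (integrable_const _)]
        simp [measureReal_def])
    have hψ' : CircContDiff ∞ (fun x => ψ x - ∫ y, ψ y) :=
      ContDiff.sub hψ (CircContDiff.const (∫ y, ψ y))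
    have h1 := h φ (circContDiff_infty_of_hasDerivAt hψ' hφ)
    rw [circDeriv_eq_of_hasDerivAt (f := fun x => ψ x - ∫ y, ψ y) hφ] at h1
    simp only [sub_smul] at h1
    rw [integral_sub (integrable_smul hψ.continuous' u) 
      (integrable_smul (φ := fun _ => ∫ y, ψ y) continuous_const u),
      integral_smul, sub_eq_zero] at h1
    have e : ∫ x, ψ x • (u - hconst.toLp _ : LTwo n) x = ∫ x, (ψ x • u x - ψ x • m) := by
      refine integral_congr_ae ?_
      filter_upwards [Lp.coeFn_sub u (hconst.toLp _), hconst.coeFn_toLp] with x h2 h3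
      rw [h2, Pi.sub_apply, h3, smul_sub]
    rw [e, integral_sub (integrable_smul hψ.continuous' u) (hψi.smul_const m), h1,
      integral_smul_const, sub_self]
  rw [sub_eq_zero] at key
  rw [key]
  exact hconst.coeFn_toLp

lemma LTwo.memLp_of_continuous {f : Circ → Euc n} (hf : Continuous f) : MemLp f 2 volume :=
  hf.memLp_of_hasCompactSupport (.of_compactSpace _)

/-- A function with a continuous weak derivative has a `C¹` representative, whose classical
derivative is the weak one. -/
lemma IsWeakDeriv.exists_classical {u v : LTwo n} (h : IsWeakDeriv u v) {V : Circ → Euc n}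
    (hV : Continuous V) (hvV : v =ᵐ[volume] V) :
    ∃ c : Circ → Euc n, u =ᵐ[volume] c ∧
      ∀ t : ℝ, HasDerivAt (fun r : ℝ => c (r : Circ)) (V (t : Circ)) t := by
  obtain ⟨c, hc⟩ := exists_primitive hV ((integral_congr_ae hvV).symm.trans h.integral_eq_zero)
  have hcc : Continuous c := (circContDiff_one_of_hasDerivAt hV hc).continuous'
  have hcm := LTwo.memLp_of_continuous hcc
  have key := ae_eq_const_of_weakDeriv_zero (u - hcm.toLp _) fun φ hφ => by
    have e : ∫ x, circDeriv φ x • (u - hcm.toLp _ : LTwo n) x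
        = ∫ x, (circDeriv φ x • u x - circDeriv φ x • c x) := by
      refine integral_congr_ae ?_
      filter_upwards [Lp.coeFn_sub u (hcm.toLp _), hcm.coeFn_toLp] with x h2 h3
      rw [h2, Pi.sub_apply, h3, smul_sub]
    rw [e, integral_sub (integrable_smul hφ.circDeriv.continuous' u)
      (integrable_smul_of_continuous hφ.circDeriv.continuous' (hcm.integrable one_le_two)),
      integral_circDeriv_smul hφ hV hc, h φ hφ, sub_neg_eq_add, neg_add_eq_zero]
    refine integral_congr_ae ?_
    filter_upwards [hvV] with x hx
    rw [hx]
  set m := ∫ x, (u - hcm.toLp _ : LTwo n) x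
  refine ⟨fun x => c x + m, ?_, fun t => (hc t).add_const m⟩
  filter_upwards [key, Lp.coeFn_sub u (hcm.toLp _), hcm.coeFn_toLp] with x h1 h2 h3
  rw [h2, Pi.sub_apply, h3] at h1
  rw [← h1]; abel

end WeakDerivative

namespace Sobolev

variable {s : ℝ} {n : ℕ}

lemma norm_weakDeriv_le (γ : Sobolev s n) : ‖γ.weakDeriv‖ ≤ ‖γ‖ := by
  refine abs_le_of_sq_le_sq' ?_ (norm_nonneg _) |>.2
  rw [norm_sq]; nlinarith [sq_nonneg ‖γ.toL2‖, sq_nonneg ‖γ.memLp_fracQuot.toLp _‖]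

lemma norm_fracQuot_le (γ : Sobolev s n) :
    (eLpNorm (fracQuot (s - 1) γ.weakDeriv) 2 volume).toReal ≤ ‖γ‖ := by
  rw [← Lp.norm_toLp _ γ.memLp_fracQuot]
  refine abs_le_of_sq_le_sq' ?_ (norm_nonneg _) |>.2
  rw [norm_sq]; nlinarith [sq_nonneg ‖γ.toL2‖, sq_nonneg ‖γ.weakDeriv‖]

lemma exists_continuous_weakDeriv (hs : 3 / 2 < s) (γ : Sobolev s n) :
    ∃ V : C(Circ, Euc n), γ.weakDeriv =ᵐ[volume] V := by
  obtain ⟨C, -, hC⟩ := exists_continuous_representative (σ := s - 1) (by linarith) n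
  obtain ⟨V, hV, -⟩ := hC γ.weakDeriv γ.memLp_fracQuot
  exact ⟨V, hV⟩

/-- The continuous representative of the weak derivative, as a bounded linear map
`H^s → C(ℝ/ℤ, ℝⁿ)` for `s > 3/2`. -/
def contDeriv (hs : 3 / 2 < s) : Sobolev s n →L[ℝ] C(Circ, Euc n) :=
  LinearMap.mkContinuousOfExistsBound
    { toFun := fun γ => (γ.exists_continuous_weakDeriv hs).choose
      map_add' := fun γ η => by
        refine DFunLike.coe_injective (Continuous.ae_eq_iff_eq volume
          (map_continuous _) (map_continuous _) |>.1 ?_)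
        filter_upwards [(γ.exists_continuous_weakDeriv hs).choose_spec,
          (η.exists_continuous_weakDeriv hs).choose_spec,
          ((γ + η).exists_continuous_weakDeriv hs).choose_spec,
          Lp.coeFn_add γ.weakDeriv η.weakDeriv] with x h1 h2 h3 h4
        rw [← h3, weakDeriv_add, h4, ContinuousMap.add_apply, ← h1, ← h2, Pi.add_apply]
      map_smul' := fun a γ => by
        refine DFunLike.coe_injective (Continuous.ae_eq_iff_eq volume
          (map_continuous _) (map_continuous _) |>.1 ?_)
        filter_upwards [(γ.exists_continuous_weakDeriv hs).choose_spec,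
          ((a • γ).exists_continuous_weakDeriv hs).choose_spec,
          Lp.coeFn_smul a γ.weakDeriv] with x h1 h3 h4
        rw [← h3, weakDeriv_smul, h4, RingHom.id_apply, ContinuousMap.smul_apply, ← h1,
          Pi.smul_apply] }
    (by
      obtain ⟨C, hC0, hC⟩ := exists_continuous_representative (σ := s - 1) (by linarith) n
      refine ⟨1 + C, fun γ => ?_⟩
      obtain ⟨V, hV, hb⟩ := hC γ.weakDeriv γ.memLp_fracQuot
      have : (γ.exists_continuous_weakDeriv hs).choose = V :=
        DFunLike.coe_injective (Continuous.ae_eq_iff_eq volume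
          (map_continuous _) (map_continuous _) |>.1
            ((γ.exists_continuous_weakDeriv hs).choose_spec.symm.trans hV))
      calc ‖(γ.exists_continuous_weakDeriv hs).choose‖ = ‖V‖ := by rw [this]
        _ ≤ _ := hb
        _ ≤ ‖γ‖ + C * ‖γ‖ := by gcongr; exacts [γ.norm_weakDeriv_le, γ.norm_fracQuot_le]
        _ = _ := by ring)

lemma weakDeriv_ae_eq (hs : 3 / 2 < s) (γ : Sobolev s n) :
    γ.weakDeriv =ᵐ[volume] contDeriv hs γ :=
  (γ.exists_continuous_weakDeriv hs).choose_spec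

end Sobolev

/-! ### Difference quotients and injective regular curves -/

/-- Base points `x ∈ ℝ/ℤ` together with steps `h ∈ [-1/2, 1/2]`. This compact space parametrizes
the pairs `(x, x + h)` of points of the circle; the pairs with `h = ±1/2` are counted twice. -/
abbrev StepSpace : Type := Circ × Set.Icc (-(1 / 2) : ℝ) (1 / 2)

section Average

variable {F : Type*} [NormedAddCommGroup F] [NormedSpace ℝ F]

/-- The bounded linear map which takes `V` to its average
`(x, h) ↦ ∫₀¹ V(x + θ h) dθ` over the arc from `x` to `x + h`. -/
def arcAverage (F : Type*) [NormedAddCommGroup F] [NormedSpace ℝ F] :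
    C(Circ, F) →L[ℝ] C(StepSpace, F) :=
  LinearMap.mkContinuous
    { toFun := fun V => ⟨fun k => ∫ θ in (0 : ℝ)..1, V (k.1 + ((θ * k.2 : ℝ) : Circ)), by
        refine intervalIntegral.continuous_parametric_intervalIntegral_of_continuous' ?_ 0 1
        have := continuous_coe_circ
        fun_prop⟩
      map_add' := fun V W => by
        have := continuous_coe_circ
        ext k
        exact intervalIntegral.integral_add (Continuous.intervalIntegrable (by fun_prop) _ _)
          (Continuous.intervalIntegrable (by fun_prop) _ _)
      map_smul' := fun a V => by
        ext k
        exact intervalIntegral.integral_smul a _ }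
    1 (fun V => by
      rw [one_mul]
      refine (ContinuousMap.norm_le _ (norm_nonneg _)).2 fun k => ?_
      have := intervalIntegral.norm_integral_le_of_norm_le_const (a := 0) (b := 1)
        (f := fun θ : ℝ => V (k.1 + ((θ * k.2 : ℝ) : Circ))) (C := ‖V‖)
        (fun θ _ => V.norm_coe_le_norm _)
      simpa using this)

lemma arcAverage_apply (V : C(Circ, F)) (k : StepSpace) :
    arcAverage F V k = ∫ θ in (0 : ℝ)..1, V (k.1 + ((θ * k.2 : ℝ) : Circ)) := rfl

/-- The step `0` at the base point `x`. -/
def zeroStep (x : Circ) : StepSpace := (x, ⟨0, by norm_num⟩)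

lemma arcAverage_zeroStep [CompleteSpace F] (V : C(Circ, F)) (x : Circ) :
    arcAverage F V (zeroStep x) = V x := by
  simp [arcAverage_apply, zeroStep]

/-- Fundamental theorem of calculus along an arc. -/
lemma sub_eq_smul_arcAverage [CompleteSpace F] {c : Circ → F} {V : C(Circ, F)}
    (hc : ∀ t : ℝ, HasDerivAt (fun r : ℝ => c (r : Circ)) (V (t : Circ)) t) (k : StepSpace) :
    c (k.1 + ((k.2 : ℝ) : Circ)) - c k.1 = (k.2 : ℝ) • arcAverage F V k := by
  obtain ⟨x, h⟩ := k
  obtain ⟨t, rfl⟩ := QuotientAddGroup.mk_surjective x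
  have h1 : ∀ θ : ℝ, HasDerivAt (fun θ : ℝ => c ((t : Circ) + ((θ * (h : ℝ) : ℝ) : Circ)))
      ((h : ℝ) • V ((t : Circ) + ((θ * (h : ℝ) : ℝ) : Circ))) θ := by
    intro θ
    have h2 : HasDerivAt (fun θ : ℝ => t + θ * (h : ℝ)) (h : ℝ) θ := by
      simpa using ((hasDerivAt_id θ).mul_const (h : ℝ)).const_add t
    have h3 := HasDerivAt.scomp (g₁ := fun r : ℝ => c (r : Circ)) θ (hc (t + θ * h)) h2
    exact h3
  have hcont : Continuous fun θ : ℝ => (h : ℝ) • V ((t : Circ) + ((θ * (h : ℝ) : ℝ) : Circ)) := by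
    have := continuous_coe_circ
    fun_prop
  have h4 := intervalIntegral.integral_eq_sub_of_hasDerivAt (a := 0) (b := 1) (fun θ _ => h1 θ)
    (hcont.intervalIntegrable _ _)
  rw [intervalIntegral.integral_smul] at h4
  simp only [one_mul, zero_mul, QuotientAddGroup.mk_zero, add_zero] at h4
  exact h4.symm

end Average

section Step

/-- The representative in `(-1/2, 1/2]` of a point of the circle. -/
def signedRep (u : Circ) : ℝ := AddCircle.measurableEquivIoc 1 (-(1 / 2)) u

lemma signedRep_mem (u : Circ) : signedRep u ∈ Set.Icc (-(1 / 2) : ℝ) (1 / 2) := by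
  have h := (AddCircle.measurableEquivIoc 1 (-(1 / 2)) u).2
  exact ⟨h.1.le, h.2.trans (by norm_num)⟩

lemma coe_signedRep (u : Circ) : (signedRep u : Circ) = u :=
  (AddCircle.measurableEquivIoc 1 (-(1 / 2))).symm_apply_apply u

lemma abs_signedRep (u : Circ) : |signedRep u| = ‖u‖ := by
  have h := (AddCircle.norm_coe_eq_abs_iff 1 (x := signedRep u) one_ne_zero).2
    (by rw [abs_one]; exact abs_le.2 (signedRep_mem u))
  rw [← h, coe_signedRep]

lemma measurable_signedRep : Measurable signedRep :=
  measurable_subtype_coe.comp (AddCircle.measurableEquivIoc 1 (-(1 / 2))).measurable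

/-- The step from `x` to `y` along a shortest arc. -/
def stepOf (z : Circ × Circ) : StepSpace := (z.1, ⟨signedRep (z.2 - z.1), signedRep_mem _⟩)

lemma measurable_stepOf : Measurable stepOf :=
  measurable_fst.prodMk
    ((measurable_signedRep.comp (measurable_snd.sub measurable_fst)).subtype_mk)

lemma stepOf_fst (z : Circ × Circ) : (stepOf z).1 = z.1 := rfl

lemma abs_stepOf_snd (z : Circ × Circ) : |((stepOf z).2 : ℝ)| = ‖z.1 - z.2‖ := by
  rw [norm_sub_rev]; exact abs_signedRep _

lemma fst_add_stepOf (z : Circ × Circ) : z.1 + (((stepOf z).2 : ℝ) : Circ) = z.2 := by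
  rw [stepOf, coe_signedRep]; abel

lemma coe_step_eq_zero_iff (h : Set.Icc (-(1 / 2) : ℝ) (1 / 2)) :
    ((h : ℝ) : Circ) = 0 ↔ (h : ℝ) = 0 := by
  rw [← norm_eq_zero, (AddCircle.norm_coe_eq_abs_iff 1 one_ne_zero).2
    (by rw [abs_one]; exact abs_le.2 h.2), abs_eq_zero]

end Step

namespace Sobolev

variable {s : ℝ} {n : ℕ}

/-- The difference quotient `(x, h) ↦ (γ(x + h) - γ(x)) / h`, extended by `γ'(x)` to `h = 0`, as a
bounded linear map on `H^s`, `s > 3/2`. -/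
def diffQuot (hs : 3 / 2 < s) : Sobolev s n →L[ℝ] C(StepSpace, Euc n) :=
  arcAverage (Euc n) ∘L contDeriv hs

lemma diffQuot_zeroStep (hs : 3 / 2 < s) (γ : Sobolev s n) (x : Circ) :
    diffQuot hs γ (zeroStep x) = contDeriv hs γ x := arcAverage_zeroStep _ _

lemma exists_classical (hs : 3 / 2 < s) (γ : Sobolev s n) :
    ∃ c : Circ → Euc n, γ.toL2 =ᵐ[volume] c ∧ CircContDiff 1 c ∧
      circDeriv c = contDeriv hs γ ∧
      ∀ k : StepSpace, c (k.1 + ((k.2 : ℝ) : Circ)) - c k.1 = (k.2 : ℝ) • diffQuot hs γ k := by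
  obtain ⟨c, h1, h2⟩ := γ.isWeakDeriv.exists_classical (map_continuous (contDeriv hs γ))
    (weakDeriv_ae_eq hs γ)
  exact ⟨c, h1, circContDiff_one_of_hasDerivAt (map_continuous _) h2,
    circDeriv_eq_of_hasDerivAt h2, sub_eq_smul_arcAverage h2⟩

/-- A curve is injective and regular if and only if its extended difference quotient vanishes
nowhere: its values at `h ≠ 0` test injectivity, those at `h = 0` regularity. -/
lemma isInjectiveRegular_iff (hs : 3 / 2 < s) (γ : Sobolev s n) :
    γ.IsInjectiveRegular ↔ ∀ k, diffQuot hs γ k ≠ 0 := by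
  obtain ⟨c, hc, hc1, hd, hq⟩ := exists_classical hs γ
  constructor
  · rintro ⟨c', hc1', hc', hinj, hreg⟩
    have : c' = c := Continuous.ae_eq_iff_eq volume hc1'.continuous' hc1.continuous' |>.1
      (hc'.symm.trans hc)
    subst this
    rintro ⟨x, h⟩ h0
    rcases eq_or_ne (h : ℝ) 0 with hh | hh
    · have hk : (x, h) = zeroStep x := Prod.ext rfl (Subtype.ext hh)
      rw [hk, diffQuot_zeroStep, ← hd] at h0
      exact hreg x h0
    · have h1 := hq (x, h)
      rw [h0, smul_zero, sub_eq_zero] at h1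
      have h2 := hinj h1
      rw [add_eq_left, coe_step_eq_zero_iff] at h2
      exact hh h2
  · intro h
    refine ⟨c, hc1, hc, fun x y hxy => ?_, fun x => ?_⟩
    · have h1 := hq (stepOf (x, y))
      rw [stepOf_fst, fst_add_stepOf, hxy, sub_self] at h1
      have h2 := (smul_eq_zero.1 h1.symm).resolve_right (h _)
      have h3 := abs_stepOf_snd (x, y)
      rw [h2, abs_zero, eq_comm, norm_eq_zero, sub_eq_zero] at h3
      exact h3
    · rw [hd, ← diffQuot_zeroStep]
      exact h _

lemma isOpen_injectiveRegular (hs : 3 / 2 < s) : IsOpen (injectiveRegular s n) := by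
  have h1 : injectiveRegular s n = diffQuot hs ⁻¹' {f | Set.MapsTo f Set.univ {0}ᶜ} := by
    ext γ
    simp [injectiveRegular, isInjectiveRegular_iff hs, Set.MapsTo]
  rw [h1]
  exact (ContinuousMap.isOpen_setOfPred_mapsTo isCompact_univ isOpen_compl_singleton).preimage
    (diffQuot hs).continuous

end Sobolev

/-! ### The Taylor remainder and Hardy's inequality -/

section Hardy

variable {n : ℕ}

lemma eLpNorm_two_sq {α F : Type*} [MeasurableSpace α] [NormedAddCommGroup F] (f : α → F)
    (μ : Measure α) : eLpNorm f 2 μ ^ 2 = ∫⁻ x, ‖f x‖ₑ ^ 2 ∂μ := by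
  have := eLpNorm_nnreal_pow_eq_lintegral (f := f) (μ := μ) (p := 2) two_ne_zero
  simpa using this

/-- Tonelli's theorem on the torus, in terms of a point and a step. -/
lemma lintegral_circ_prod {f : Circ × Circ → ℝ≥0∞} (hf : Measurable f) :
    ∫⁻ z, f z = ∫⁻ t in Set.Ioc (-(1 / 2) : ℝ) (1 / 2), ∫⁻ x, f (x, x + (t : Circ)) := by
  rw [Measure.volume_eq_prod, lintegral_prod _ hf.aemeasurable]
  have h1 : ∀ x : Circ, ∫⁻ y, f (x, y) = ∫⁻ t in Set.Ioc (-(1 / 2) : ℝ) (1 / 2), f (x, x + (t : Circ)) := by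
    intro x
    rw [← lintegral_add_left_eq_self (fun y => f (x, y)) x,
      ← UnitAddCircle.lintegral_preimage (-(1 / 2)) (fun u => f (x, x + u))]
    norm_num
  simp only [h1]
  refine lintegral_lintegral_swap (Measurable.aemeasurable ?_)
  have := continuous_coe_circ.measurable
  exact hf.comp (by fun_prop)

lemma enorm_integral_sq_le {F : Type*} [NormedAddCommGroup F] [NormedSpace ℝ F] {f : ℝ → F}
    (hf : Continuous f) :
    ‖∫ θ in (0 : ℝ)..1, f θ‖ₑ ^ 2 ≤ ∫⁻ θ in Set.Ioc (0 : ℝ) 1, ‖f θ‖ₑ ^ 2 := by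
  rw [intervalIntegral.integral_of_le zero_le_one, ← eLpNorm_two_sq]
  have h1 := eLpNorm_le_eLpNorm_mul_rpow_measure_univ (p := 1) (q := 2)
    (μ := volume.restrict (Set.Ioc (0 : ℝ) 1)) one_le_two hf.aestronglyMeasurable
  have h2 := (enorm_integral_le_lintegral_enorm (μ := volume.restrict (Set.Ioc (0 : ℝ) 1)) f)
  rw [← eLpNorm_one_eq_lintegral_enorm] at h2
  gcongr
  refine h2.trans (h1.trans (le_of_eq ?_))
  simp

/-- The substitution `θ t ↦ t` with `0 < θ ≤ 1`, which maps the interval of integration into itself. -/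
lemma lintegral_comp_mul_le {g : ℝ → ℝ≥0∞} (hg : Measurable g) {θ : ℝ} (h0 : 0 < θ) (h1 : θ ≤ 1) :
    ∫⁻ t in Set.Ioc (-(1 / 2) : ℝ) (1 / 2), g (θ * t)
      ≤ ENNReal.ofReal θ⁻¹ * ∫⁻ t in Set.Ioc (-(1 / 2) : ℝ) (1 / 2), g t := by
  set I := Set.Ioc (-(1 / 2) : ℝ) (1 / 2)
  have hI : MeasurableSet I := measurableSet_Ioc
  calc ∫⁻ t in I, g (θ * t) ≤ ∫⁻ t in I, I.indicator g (θ * t) := by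
        refine setLIntegral_mono' hI fun t ht => ?_
        have : θ * t ∈ I := ⟨by nlinarith [ht.1, ht.2], by nlinarith [ht.1, ht.2]⟩
        rw [Set.indicator_of_mem this]
    _ ≤ ∫⁻ t, I.indicator g (θ * t) := setLIntegral_le_lintegral _ _
    _ = ∫⁻ t, I.indicator g t ∂(Measure.map (θ * ·) volume) :=
        (lintegral_map (hg.indicator hI) (measurable_const_mul θ)).symm
    _ = _ := by
        rw [Real.map_volume_mul_left h0.ne', lintegral_smul_measure, lintegral_indicator hI,
          abs_of_pos (inv_pos.2 h0), smul_eq_mul]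

lemma signedRep_coe {t : ℝ} (ht : t ∈ Set.Ioc (-(1 / 2) : ℝ) (1 / 2)) : signedRep (t : Circ) = t := by
  have h : t ∈ Set.Ioc (-(1 / 2) : ℝ) (-(1 / 2) + 1) := ⟨ht.1, ht.2.trans (by norm_num)⟩
  exact congrArg Subtype.val ((AddCircle.measurableEquivIoc 1 (-(1 / 2))).apply_symm_apply ⟨t, h⟩)

lemma norm_coe_circ {t : ℝ} (ht : t ∈ Set.Ioc (-(1 / 2) : ℝ) (1 / 2)) : ‖(t : Circ)‖ = |t| := by
  rw [← abs_signedRep, signedRep_coe ht]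

/-- The Taylor remainder `(c(y) - c(x) - h c'(x)) / |h|^(s + 1/2)` of a curve `c` with derivative
`V`, where `h` is the step from `x` to `y` and `c(y) - c(x)` is `h` times the average of `V` over
the arc. -/
def taylorQuot (s : ℝ) (V : C(Circ, Euc n)) (z : Circ × Circ) : Euc n :=
  (‖z.1 - z.2‖ ^ (s + 1 / 2))⁻¹ •
    (((stepOf z).2 : ℝ) • (arcAverage (Euc n) V (stepOf z) - V z.1))

lemma measurable_taylorQuot (s : ℝ) (V : C(Circ, Euc n)) : Measurable (taylorQuot s V) := by
  have h1 := (arcAverage (Euc n) V).continuous.measurable.comp measurable_stepOf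
  have h2 : Measurable fun z : Circ × Circ => ((stepOf z).2 : ℝ) :=
    measurable_subtype_coe.comp (measurable_snd.comp measurable_stepOf)
  have h3 : Measurable fun z : Circ × Circ => V z.1 := V.continuous.measurable.comp measurable_fst
  have h4 : Measurable fun z : Circ × Circ => (‖z.1 - z.2‖ ^ (s + 1 / 2))⁻¹ := by fun_prop
  exact h4.smul (h2.smul (h1.sub h3))

lemma measurable_fracQuot (σ : ℝ) (V : C(Circ, Euc n)) : Measurable (fracQuot σ V) := by
  have h3 : Measurable fun z : Circ × Circ => V z.1 := V.continuous.measurable.comp measurable_fst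
  have h5 : Measurable fun z : Circ × Circ => V z.2 := V.continuous.measurable.comp measurable_snd
  have h4 : Measurable fun z : Circ × Circ => (‖z.1 - z.2‖ ^ (σ + 1 / 2))⁻¹ := by fun_prop
  exact h4.smul (h3.sub h5)

/-- The Cauchy-Schwarz inequality for the average over the arc from `x` to `x + t`. -/
lemma enorm_taylorQuot_sq_le {s : ℝ} (V : C(Circ, Euc n)) (x : Circ) {t : ℝ}
    (ht : t ∈ Set.Ioc (-(1 / 2) : ℝ) (1 / 2)) :
    ‖taylorQuot s V (x, x + (t : Circ))‖ₑ ^ 2 ≤ ∫⁻ θ in Set.Ioc (0 : ℝ) 1,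
      ENNReal.ofReal (|t| ^ (1 - 2 * s)) * ‖V (x + ((θ * t : ℝ) : Circ)) - V x‖ₑ ^ 2 := by
  have hstep : ((stepOf (x, x + (t : Circ))).2 : ℝ) = t := by
    simp only [stepOf, add_sub_cancel_left, signedRep_coe ht]
  have hnorm : ‖x - (x + (t : Circ))‖ = |t| := by
    rw [sub_add_cancel_left, norm_neg, norm_coe_circ ht]
  rcases eq_or_ne t 0 with h0 | h0
  · rw [taylorQuot, hstep, h0]
    simp
  have hc : Continuous fun θ : ℝ => V (x + ((θ * t : ℝ) : Circ)) - V x := by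
    have := continuous_coe_circ
    fun_prop
  have h1 : arcAverage (Euc n) V (stepOf (x, x + (t : Circ))) - V x
      = ∫ θ in (0 : ℝ)..1, (V (x + ((θ * t : ℝ) : Circ)) - V x) := by
    rw [arcAverage_apply, intervalIntegral.integral_sub, hstep]
    · simp [stepOf_fst]
    · have := continuous_coe_circ
      exact Continuous.intervalIntegrable (by fun_prop) _ _
    · simp
  have hpos : 0 < |t| := abs_pos.2 h0
  have h2 : ‖(|t| ^ (s + 1 / 2))⁻¹‖ₑ ^ 2 * ‖t‖ₑ ^ 2 = ENNReal.ofReal (|t| ^ (1 - 2 * s)) := by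
    rw [← mul_pow, ← enorm_mul, ← ofReal_norm, ← ENNReal.ofReal_pow (norm_nonneg _), norm_mul,
      norm_inv, Real.norm_of_nonneg (by positivity), Real.norm_eq_abs, ← Real.rpow_neg hpos.le]
    congr 1
    nth_rewrite 2 [← Real.rpow_one |t|]
    rw [← Real.rpow_add hpos, ← Real.rpow_natCast, ← Real.rpow_mul hpos.le]
    congr 1
    push_cast
    ring
  rw [taylorQuot, hnorm, hstep, h1, enorm_smul, enorm_smul, mul_pow, mul_pow, ← mul_assoc, h2,
    lintegral_const_mul _ (by fun_prop)]
  gcongr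
  exact enorm_integral_sq_le hc

lemma enorm_fracQuot_sq {s : ℝ} (V : C(Circ, Euc n)) (x : Circ) {t : ℝ}
    (ht : t ∈ Set.Ioc (-(1 / 2) : ℝ) (1 / 2)) :
    ‖fracQuot (s - 1) V (x, x + (t : Circ))‖ₑ ^ 2 =
      ENNReal.ofReal (|t| ^ (1 - 2 * s)) * ‖V (x + (t : Circ)) - V x‖ₑ ^ 2 := by
  have hnorm : ‖x - (x + (t : Circ))‖ = |t| := by
    rw [sub_add_cancel_left, norm_neg, norm_coe_circ ht]
  rcases eq_or_ne t 0 with h0 | h0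
  -- at `t = 0` the difference of values of `V` vanishes, whatever the weight is
  · simp [fracQuot, h0]
  have hpos : 0 < |t| := abs_pos.2 h0
  rw [fracQuot, hnorm, enorm_smul, mul_pow, ← neg_sub (V (x + (t : Circ))), enorm_neg]
  congr 1
  rw [← ofReal_norm, ← ENNReal.ofReal_pow (norm_nonneg _), norm_inv,
    Real.norm_of_nonneg (by positivity), ← Real.rpow_neg hpos.le, ← Real.rpow_natCast,
    ← Real.rpow_mul hpos.le]
  congr 2
  push_cast
  ring

/-- A **Hardy inequality**: the Taylor remainder of order `s + 1/2` of a curve is bounded in `L²` by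
the Gagliardo seminorm of order `s - 1` of its derivative. By Cauchy-Schwarz the average over an arc
is controlled by the points `x + θ t`, `0 < θ ≤ 1`, of the arc, and for each `θ` the substitution
`θ t ↦ t` gives the factor `θ^(2 s - 2) ≤ 1`. -/
lemma eLpNorm_taylorQuot_le {s : ℝ} (hs : 1 ≤ s) (V : C(Circ, Euc n)) :
    eLpNorm (taylorQuot s V) 2 volume ≤ eLpNorm (fracQuot (s - 1) V) 2 volume := by
  set I := Set.Ioc (-(1 / 2) : ℝ) (1 / 2)
  have hI : MeasurableSet I := measurableSet_Ioc
  have hcoe := continuous_coe_circ.measurable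
  have hVm := V.continuous.measurable
  set w : ℝ → ℝ≥0∞ := fun t => ENNReal.ofReal (|t| ^ (1 - 2 * s)) with hw
  have hwm : Measurable w := by fun_prop
  set G : ℝ → ℝ≥0∞ := fun t => ∫⁻ x, ‖V (x + (t : Circ)) - V x‖ₑ ^ 2 with hG
  have hGm : Measurable G := by
    refine Measurable.lintegral_prod_right'
      (f := fun q : ℝ × Circ => ‖V (q.2 + (q.1 : Circ)) - V q.2‖ₑ ^ 2) ?_
    fun_prop
  have hwG : Measurable fun t => w t * G t := hwm.mul hGm
  have hR : ∫⁻ z, ‖fracQuot (s - 1) V z‖ₑ ^ 2 = ∫⁻ t in I, w t * G t := by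
    rw [lintegral_circ_prod ((measurable_fracQuot (s - 1) V).enorm.pow_const 2)]
    refine setLIntegral_congr_fun hI fun t ht => ?_
    simp only [enorm_fracQuot_sq V _ ht]
    exact lintegral_const_mul _ (by fun_prop)
  have hscale : ∀ θ ∈ Set.Ioc (0 : ℝ) 1, ∫⁻ t in I, w t * G (θ * t) ≤ ∫⁻ t in I, w t * G t := by
    intro θ hθ
    have h1 : ∀ t, w t = ENNReal.ofReal (θ ^ (2 * s - 1)) * w (θ * t) := fun t => by
      rw [hw]
      simp only
      rw [← ENNReal.ofReal_mul (by have := hθ.1; positivity), abs_mul, abs_of_pos hθ.1,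
        Real.mul_rpow hθ.1.le (abs_nonneg _), ← mul_assoc, ← Real.rpow_add hθ.1]
      simp
    calc ∫⁻ t in I, w t * G (θ * t)
        = ENNReal.ofReal (θ ^ (2 * s - 1)) * ∫⁻ t in I, w (θ * t) * G (θ * t) := by
          rw [← lintegral_const_mul _ (by fun_prop)]
          refine lintegral_congr fun t => ?_
          rw [h1 t, mul_assoc]
      _ ≤ ENNReal.ofReal (θ ^ (2 * s - 1)) * (ENNReal.ofReal θ⁻¹ * ∫⁻ t in I, w t * G t) := by
          gcongr
          exact lintegral_comp_mul_le hwG hθ.1 hθ.2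
      _ ≤ 1 * ∫⁻ t in I, w t * G t := by
          rw [← mul_assoc, ← ENNReal.ofReal_mul (by have := hθ.1; positivity)]
          gcongr
          rw [← ENNReal.ofReal_one]
          refine ENNReal.ofReal_le_ofReal ?_
          rw [← Real.rpow_neg_one, ← Real.rpow_add hθ.1]
          exact Real.rpow_le_one hθ.1.le hθ.2 (by linarith)
      _ = _ := one_mul _
  have key : ∫⁻ z, ‖taylorQuot s V z‖ₑ ^ 2 ≤ ∫⁻ z, ‖fracQuot (s - 1) V z‖ₑ ^ 2 := by
    rw [lintegral_circ_prod ((measurable_taylorQuot s V).enorm.pow_const 2), hR]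
    calc ∫⁻ t in I, ∫⁻ x, ‖taylorQuot s V (x, x + (t : Circ))‖ₑ ^ 2
        ≤ ∫⁻ t in I, ∫⁻ x, ∫⁻ θ in Set.Ioc (0 : ℝ) 1,
          w t * ‖V (x + ((θ * t : ℝ) : Circ)) - V x‖ₑ ^ 2 :=
          setLIntegral_mono' hI fun t ht => lintegral_mono fun x => enorm_taylorQuot_sq_le V x ht
      _ = ∫⁻ t in I, ∫⁻ θ in Set.Ioc (0 : ℝ) 1, w t * G (θ * t) := by
          refine lintegral_congr fun t => ?_
          rw [lintegral_lintegral_swap (Measurable.aemeasurable (by fun_prop))]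
          refine lintegral_congr fun θ => ?_
          exact lintegral_const_mul _ (by fun_prop)
      _ = ∫⁻ θ in Set.Ioc (0 : ℝ) 1, ∫⁻ t in I, w t * G (θ * t) :=
          lintegral_lintegral_swap (Measurable.aemeasurable (by fun_prop))
      _ ≤ ∫⁻ _ in Set.Ioc (0 : ℝ) 1, ∫⁻ t in I, w t * G t :=
          setLIntegral_mono' measurableSet_Ioc hscale
      _ = _ := by simp
  rw [← eLpNorm_two_sq, ← eLpNorm_two_sq] at key
  exact (ENNReal.pow_le_pow_left_iff two_ne_zero).1 key

end Hardy

namespace Sobolev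

variable {s : ℝ} {n : ℕ}

lemma fracQuot_ae_eq (hs : 3 / 2 < s) (γ : Sobolev s n) :
    fracQuot (s - 1) γ.weakDeriv =ᵐ[volume] fracQuot (s - 1) (contDeriv hs γ) := by
  have h := weakDeriv_ae_eq hs γ
  filter_upwards [Measure.quasiMeasurePreserving_fst.ae h,
    Measure.quasiMeasurePreserving_snd.ae h] with z h1 h2
  simp only [fracQuot, h1, h2]

lemma memLp_taylorQuot (hs : 3 / 2 < s) (γ : Sobolev s n) :
    MemLp (taylorQuot s (contDeriv hs γ)) 2 volume := by
  refine ⟨(measurable_taylorQuot s _).aestronglyMeasurable,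
    (eLpNorm_taylorQuot_le (by linarith) _).trans_lt ?_⟩
  rw [← eLpNorm_congr_ae (fracQuot_ae_eq hs γ)]
  exact γ.memLp_fracQuot.2

/-- The Taylor remainder quotient as a bounded linear map from `H^s` to `L²` of the torus. -/
def taylor (hs : 3 / 2 < s) : Sobolev s n →L[ℝ] LTwoProd n :=
  LinearMap.mkContinuous
    { toFun := fun γ => (memLp_taylorQuot hs γ).toLp _
      map_add' := fun γ η => by
        rw [← MemLp.toLp_add]
        refine MemLp.toLp_congr _ _ (ae_of_all _ fun z => ?_)
        simp only [taylorQuot, map_add, ContinuousMap.add_apply, Pi.add_apply, ← smul_add]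
        congr 2
        abel
      map_smul' := fun a γ => by
        rw [← MemLp.toLp_const_smul]
        refine MemLp.toLp_congr _ _ (ae_of_all _ fun z => ?_)
        simp only [taylorQuot, map_smul, ContinuousMap.smul_apply, Pi.smul_apply,
          ← smul_sub, RingHom.id_apply, smul_comm _ a] }
    1 (fun γ => by
      rw [one_mul]
      refine le_trans ?_ γ.norm_fracQuot_le
      change ‖(memLp_taylorQuot hs γ).toLp _‖ ≤ _
      rw [Lp.norm_toLp]
      refine ENNReal.toReal_mono γ.memLp_fracQuot.2.ne ?_
      rw [eLpNorm_congr_ae (fracQuot_ae_eq hs γ)]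
      exact eLpNorm_taylorQuot_le (by linarith) _)

lemma taylor_ae_eq (hs : 3 / 2 < s) (γ : Sobolev s n) :
    taylor hs γ =ᵐ[volume] taylorQuot s (contDeriv hs γ) :=
  (memLp_taylorQuot hs γ).coeFn_toLp

end Sobolev

/-! ### Real powers in the algebra of continuous functions -/

section RealPower

variable {X : Type*} [TopologicalSpace X] [CompactSpace X] [Nonempty X]

lemma one_le_radius_binomialSeries (α : ℝ) : 1 ≤ (binomialSeries C(X, ℝ) α).radius := by
  refine (binomialSeries_radius_ge_one (𝕂 := ℝ) (𝔸 := ℝ) (a := α)).trans ?_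
  refine ENNReal.le_of_forall_nnreal_lt fun r hr => ?_
  obtain ⟨C, -, hC⟩ := FormalMultilinearSeries.norm_mul_pow_le_of_lt_radius _ hr
  refine FormalMultilinearSeries.le_radius_of_bound _ C fun k => ?_
  simpa only [binomialSeries, FormalMultilinearSeries.ofScalars_norm] using hC k

/-- The superposition operator `f ↦ f^α` is real analytic on the positive functions in the Banach
algebra `C(X, ℝ)`: near `f₀` it is `f₀^α` times the binomial series in `(f - f₀) / f₀`. -/
lemma exists_analyticAt_rpow (α : ℝ) (f₀ : C(X, ℝ)) (h₀ : ∀ x, 0 < f₀ x) :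
    ∃ Φ : C(X, ℝ) → C(X, ℝ), AnalyticAt ℝ Φ f₀ ∧ ∀ᶠ f in 𝓝 f₀, ∀ x, Φ f x = f x ^ α := by
  set P := binomialSeries C(X, ℝ) α
  have hP : HasFPowerSeriesOnBall P.sum P 0 P.radius :=
    P.hasFPowerSeriesOnBall (zero_lt_one.trans_le (one_le_radius_binomialSeries α))
  set g : C(X, ℝ) := ⟨fun x => f₀ x ^ α, f₀.continuous.rpow_const fun x => Or.inl (h₀ x).ne'⟩
  set i : C(X, ℝ) := ⟨fun x => (f₀ x)⁻¹, f₀.continuous.inv₀ fun x => (h₀ x).ne'⟩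
  have hw : AnalyticAt ℝ (fun f : C(X, ℝ) => (f - f₀) * i) f₀ :=
    (analyticAt_id.sub analyticAt_const).mul analyticAt_const
  have hw0 : (f₀ - f₀) * i = 0 := by simp
  refine ⟨fun f => g * P.sum ((f - f₀) * i), analyticAt_const.mul ?_, ?_⟩
  · exact AnalyticAt.comp (g := P.sum) (by rw [hw0]; exact hP.analyticAt) hw
  · have hnear : ∀ᶠ f in 𝓝 f₀, ‖(f - f₀) * i‖ < 1 := by
      have h1 : Tendsto (fun f : C(X, ℝ) => ‖(f - f₀) * i‖) (𝓝 f₀) (𝓝 ‖(f₀ - f₀) * i‖) :=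
        hw.continuousAt.norm
      rw [hw0, norm_zero] at h1
      exact (tendsto_order.1 h1).2 1 one_pos
    filter_upwards [hnear] with f hf x
    set w := (f - f₀) * i
    have hwx : ‖w x‖ < 1 := (w.norm_coe_le_norm x).trans_lt hf
    have h1 : HasSum (fun k => P k fun _ => w) (P.sum w) := by
      have := hP.hasSum (y := w) (by
        refine Metric.eball_subset_eball (one_le_radius_binomialSeries α) ?_
        rw [Metric.mem_eball, edist_zero_right, ← ofReal_norm]
        exact ENNReal.ofReal_lt_one.2 hf)
      rwa [zero_add] at this
    have h2 := (ContinuousMap.evalCLM ℝ x).hasSum h1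
    have h3 := (Real.one_add_rpow_hasFPowerSeriesOnBall_zero (a := α)).hasSum (y := w x) (by
        rw [Metric.mem_eball, edist_zero_right, ← ofReal_norm]
        exact ENNReal.ofReal_lt_one.2 hwx)
    have h4 : P.sum w x = (1 + w x) ^ α := by
      rw [zero_add] at h3
      refine h2.unique ?_
      convert! h3 using 2 with k
      simp [P, -FormalMultilinearSeries.apply_eq_prod_smul_coeff]
    have h5 : 1 + w x = f x * (f₀ x)⁻¹ := by
      simp only [w, i, ContinuousMap.mul_apply, ContinuousMap.sub_apply, ContinuousMap.coe_mk]
      field_simp [(h₀ x).ne']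
      ring
    have h6 : 0 < 1 + w x := by linarith [(abs_lt.1 hwx).1]
    calc g x * P.sum w x = f₀ x ^ α * (1 + w x) ^ α := by rw [h4]; rfl
      _ = (f₀ x * (1 + w x)) ^ α := (Real.mul_rpow (h₀ x).le h6.le).symm
      _ = f x ^ α := by
        rw [h5]
        congr 1
        field_simp [(h₀ x).ne']

end RealPower

/-! ### Weighted square integrals and the normal projection -/

section NormPower

variable {X : Type*} [TopologicalSpace X] [CompactSpace X] [Nonempty X] {n : ℕ}

/-- If `L : H → C(X, ℝⁿ)` is bounded linear and `L γ₀` vanishes nowhere, then `γ ↦ |L γ|^α` is a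
real analytic map from a neighbourhood of `γ₀` to `C(X, ℝ)`. -/
lemma exists_analyticAt_norm_rpow {H : Type*} [NormedAddCommGroup H] [NormedSpace ℝ H]
    (L : H →L[ℝ] C(X, Euc n)) (α : ℝ) {γ₀ : H} (h₀ : ∀ x, L γ₀ x ≠ 0) :
    ∃ Φ : H → C(X, ℝ), AnalyticAt ℝ Φ γ₀ ∧ ∀ᶠ γ in 𝓝 γ₀, ∀ x, Φ γ x = ‖L γ x‖ ^ α := by
  set S : H → C(X, ℝ) := fun γ => ∑ i : Fin n,
    ((EuclideanSpace.proj (𝕜 := ℝ) i : Euc n →L[ℝ] ℝ).compLeftContinuous ℝ X ∘L L) γ *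
      ((EuclideanSpace.proj (𝕜 := ℝ) i : Euc n →L[ℝ] ℝ).compLeftContinuous ℝ X ∘L L) γ
  have hS : ∀ γ x, S γ x = ‖L γ x‖ ^ 2 := fun γ x => by
    rw [EuclideanSpace.real_norm_sq_eq]
    simp only [S, sq]
    rw [ContinuousMap.sum_apply]
    rfl
  have hSa : AnalyticAt ℝ S γ₀ := Finset.analyticAt_fun_sum _ fun i _ =>
    (ContinuousLinearMap.analyticAt _ _).mul (ContinuousLinearMap.analyticAt _ _)
  obtain ⟨Φ, hΦ, hev⟩ := exists_analyticAt_rpow (α / 2) (S γ₀) fun x => by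
    rw [hS]; have := norm_pos_iff.2 (h₀ x); positivity
  refine ⟨Φ ∘ S, hΦ.comp hSa, ?_⟩
  filter_upwards [hSa.continuousAt.eventually hev] with γ hγ x
  rw [Function.comp_apply, hγ x, hS, ← Real.rpow_natCast, ← Real.rpow_mul (norm_nonneg _)]
  congr 1
  push_cast
  ring

end NormPower

section Pullback

lemma memLp_comp_stepOf {F : Type*} [NormedAddCommGroup F] (f : C(StepSpace, F)) :
    MemLp (fun z => f (stepOf z)) ∞ (volume : Measure (Circ × Circ)) :=
  memLp_top_of_bound
    (f.continuous.stronglyMeasurable.comp_measurable measurable_stepOf).aestronglyMeasurable ‖f‖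
    (ae_of_all _ fun _ => f.norm_coe_le_norm _)

variable {F : Type*} [NormedAddCommGroup F] [NormedSpace ℝ F]

/-- Precomposition with a continuous map, as a bounded linear map. -/
def precomp {X Y : Type*} [TopologicalSpace X] [CompactSpace X] [TopologicalSpace Y]
    [CompactSpace Y] (F : Type*) [NormedAddCommGroup F] [NormedSpace ℝ F] (π : C(X, Y)) :
    C(Y, F) →L[ℝ] C(X, F) :=
  LinearMap.mkContinuous
    { toFun := fun f => f.comp π
      map_add' := fun _ _ => rfl
      map_smul' := fun _ _ => rfl }
    1 (fun f => by
      rw [one_mul]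
      exact (ContinuousMap.norm_le _ (norm_nonneg _)).2 fun x => f.norm_coe_le_norm _)

/-- The bounded function `z ↦ f (stepOf z)` on the torus defined by a continuous function of base
point and step. -/
def toTorus (F : Type*) [NormedAddCommGroup F] [NormedSpace ℝ F] :
    C(StepSpace, F) →L[ℝ] Lp F ∞ (volume : Measure (Circ × Circ)) :=
  LinearMap.mkContinuous
    { toFun := fun f => (memLp_comp_stepOf f).toLp _
      map_add' := fun f g => MemLp.toLp_add (memLp_comp_stepOf f) (memLp_comp_stepOf g)
      map_smul' := fun a f => MemLp.toLp_const_smul a (memLp_comp_stepOf f) }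
    1 (fun f => by
      rw [one_mul]
      refine (Lp.norm_le_of_ae_bound (C := ‖f‖) (norm_nonneg _) ?_).trans (by simp)
      filter_upwards [(memLp_comp_stepOf f).coeFn_toLp] with z hz
      change ‖(memLp_comp_stepOf f).toLp _ z‖ ≤ _
      rw [hz]
      exact f.norm_coe_le_norm _)

lemma toTorus_ae_eq (f : C(StepSpace, F)) :
    toTorus F f =ᵐ[volume] fun z => f (stepOf z) := (memLp_comp_stepOf f).coeFn_toLp

/-- Multiplication of an `L²`-function on the torus by a bounded weight. -/
def weightMul (F : Type*) [NormedAddCommGroup F] [NormedSpace ℝ F] :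
    C(StepSpace, ℝ) →L[ℝ] Lp F 2 (volume : Measure (Circ × Circ)) →L[ℝ]
      Lp F 2 (volume : Measure (Circ × Circ)) :=
  (ContinuousLinearMap.lsmul ℝ ℝ : ℝ →L[ℝ] F →L[ℝ] F).holderL volume ∞ 2 2 ∘L toTorus ℝ

lemma weightMul_ae_eq (a : C(StepSpace, ℝ)) (f : Lp F 2 (volume : Measure (Circ × Circ))) :
    weightMul F a f =ᵐ[volume] fun z => a (stepOf z) • f z := by
  have h := (ContinuousLinearMap.lsmul ℝ ℝ : ℝ →L[ℝ] F →L[ℝ] F).coeFn_holder (r := 2)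
    (toTorus ℝ a) f
  filter_upwards [h, toTorus_ae_eq a] with z h1 h2
  refine h1.trans ?_
  rw [h2]
  rfl

/-- The pointwise inner product of an `L²`-function on the torus with a bounded function. -/
def innerMul (n : ℕ) :
    C(StepSpace, Euc n) →L[ℝ] LTwoProd n →L[ℝ] Lp ℝ 2 (volume : Measure (Circ × Circ)) :=
  (innerSL ℝ : Euc n →L[ℝ] Euc n →L[ℝ] ℝ).holderL volume ∞ 2 2 ∘L toTorus (Euc n)

lemma innerMul_ae_eq {n : ℕ} (a : C(StepSpace, Euc n)) (f : LTwoProd n) :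
    innerMul n a f =ᵐ[volume] fun z => inner ℝ (a (stepOf z)) (f z) := by
  have h := (innerSL ℝ : Euc n →L[ℝ] Euc n →L[ℝ] ℝ).coeFn_holder (r := 2)
    (toTorus (Euc n) a) f
  filter_upwards [h, toTorus_ae_eq a] with z h1 h2
  refine h1.trans ?_
  rw [h2]
  rfl

end Pullback

section WeightedSquare

variable {F : Type*} [NormedAddCommGroup F] [InnerProductSpace ℝ F]

/-- The weighted square integral `∫ a |f|²` of an `L²`-function on the torus. -/
def weightedSq (a : C(StepSpace, ℝ)) (f : Lp F 2 (volume : Measure (Circ × Circ))) : ℝ :=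
  inner ℝ (weightMul F a f) f

lemma inner_weightMul_ae_eq (a : C(StepSpace, ℝ)) (f : Lp F 2 (volume : Measure (Circ × Circ))) :
    (fun z => inner ℝ (weightMul F a f z) (f z)) =ᵐ[volume]
      fun z => a (stepOf z) * ‖f z‖ ^ 2 := by
  filter_upwards [weightMul_ae_eq a f] with z hz
  rw [hz, real_inner_smul_left, real_inner_self_eq_norm_sq]

lemma integrable_weightedSq (a : C(StepSpace, ℝ)) (f : Lp F 2 (volume : Measure (Circ × Circ))) :
    Integrable (fun z => a (stepOf z) * ‖f z‖ ^ 2) (volume : Measure (Circ × Circ)) :=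
  (L2.integrable_inner (𝕜 := ℝ) (weightMul F a f) f).congr (inner_weightMul_ae_eq a f)

lemma weightedSq_eq_integral (a : C(StepSpace, ℝ)) (f : Lp F 2 (volume : Measure (Circ × Circ))) :
    weightedSq a f = ∫ z : Circ × Circ, a (stepOf z) * ‖f z‖ ^ 2 := by
  rw [weightedSq, L2.inner_def]
  exact integral_congr_ae (inner_weightMul_ae_eq a f)

lemma analyticAt_weightedSq {H : Type*} [NormedAddCommGroup H] [NormedSpace ℝ H]
    {a : H → C(StepSpace, ℝ)} {f : H → Lp F 2 (volume : Measure (Circ × Circ))} {γ₀ : H}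
    (ha : AnalyticAt ℝ a γ₀) (hf : AnalyticAt ℝ f γ₀) :
    AnalyticAt ℝ (fun γ => weightedSq (a γ) (f γ)) γ₀ := by
  have h1 : AnalyticAt ℝ (fun γ => weightMul F (a γ) (f γ)) γ₀ :=
    ((weightMul F).analyticAt_bilinear (a γ₀, f γ₀)).comp₂ ha hf
  exact ((innerSL ℝ).analyticAt_bilinear (weightMul F (a γ₀) (f γ₀), f γ₀)).comp₂ h1 hf

end WeightedSquare

section NormalProjection

variable {n : ℕ}

lemma normalProj_eq (τ v : Euc n) :
    normalProj τ v = v - (inner ℝ τ v / ‖τ‖ ^ 2) • τ := by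
  rw [normalProj, Submodule.starProjection_orthogonal_val, Submodule.starProjection_singleton]
  rfl

lemma norm_normalProj_sq {τ : Euc n} (hτ : τ ≠ 0) (v : Euc n) :
    ‖normalProj τ v‖ ^ 2 = ‖v‖ ^ 2 - inner ℝ τ v ^ 2 / ‖τ‖ ^ 2 := by
  have h : ‖τ‖ ≠ 0 := norm_ne_zero_iff.2 hτ
  rw [normalProj_eq, norm_sub_sq_real, norm_smul, real_inner_smul_right, real_inner_comm,
    mul_pow, Real.norm_eq_abs, sq_abs]
  field_simp
  ring

lemma normalProj_smul (τ v : Euc n) (r : ℝ) : normalProj τ (r • v) = r • normalProj τ v :=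
  map_smul _ _ _

lemma normalProj_sub_self (τ v : Euc n) : normalProj τ (v - τ) = normalProj τ v := by
  rw [normalProj, map_sub]
  have : (ℝ ∙ τ)ᗮ.starProjection τ = 0 := by
    rw [Submodule.starProjection_apply_eq_zero_iff, Submodule.orthogonal_orthogonal]
    exact Submodule.mem_span_singleton_self τ
  rw [this, sub_zero, normalProj]

end NormalProjection

/-! ### Analyticity of the energy -/

namespace Sobolev

variable {s : ℝ} {n : ℕ}

/-- The derivative `(x, h) ↦ γ'(x)` at the base point. -/
def baseDeriv (hs : 3 / 2 < s) : Sobolev s n →L[ℝ] C(StepSpace, Euc n) :=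
  precomp (Euc n) ⟨fun k => k.1, continuous_fst⟩ ∘L contDeriv hs

/-- The derivative `(x, h) ↦ γ'(x + h)` at the end of the step. -/
def tipDeriv (hs : 3 / 2 < s) : Sobolev s n →L[ℝ] C(StepSpace, Euc n) :=
  precomp (Euc n) ⟨fun k => k.1 + ((k.2 : ℝ) : Circ), by
    have := continuous_coe_circ
    fun_prop⟩ ∘L contDeriv hs

lemma baseDeriv_apply (hs : 3 / 2 < s) (γ : Sobolev s n) (k : StepSpace) :
    baseDeriv hs γ k = contDeriv hs γ k.1 := rfl

lemma tipDeriv_apply (hs : 3 / 2 < s) (γ : Sobolev s n) (k : StepSpace) :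
    tipDeriv hs γ k = contDeriv hs γ (k.1 + ((k.2 : ℝ) : Circ)) := rfl

/-- The integrand of the energy in terms of the Taylor remainder quotient: the normal projection
annihilates the linear part `h γ'(x)` of `γ(y) - γ(x)`, and the powers of `|h|` in the numerator
and the denominator cancel because `p = 2 s + 1`. -/
lemma energy_integrand_eq {p : ℝ} (hp : s = (p - 1) / 2) (hs : 3 / 2 < s) {γ : Sobolev s n}
    (hγ : ∀ k, diffQuot hs γ k ≠ 0) {c : Circ → Euc n}
    (hc : ∀ k : StepSpace, c (k.1 + ((k.2 : ℝ) : Circ)) - c k.1 = (k.2 : ℝ) • diffQuot hs γ k)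
    (z : Circ × Circ) :
    ‖normalProj (contDeriv hs γ z.1) (c z.2 - c z.1)‖ ^ (2 : ℝ) / ‖c z.2 - c z.1‖ ^ p
        * ‖contDeriv hs γ z.1‖ * ‖contDeriv hs γ z.2‖ =
      ‖diffQuot hs γ (stepOf z)‖ ^ (-p) * ‖baseDeriv hs γ (stepOf z)‖ ^ (1 : ℝ)
          * ‖tipDeriv hs γ (stepOf z)‖ ^ (1 : ℝ) * ‖taylorQuot s (contDeriv hs γ) z‖ ^ 2
        - ‖diffQuot hs γ (stepOf z)‖ ^ (-p) * ‖baseDeriv hs γ (stepOf z)‖ ^ (-1 : ℝ)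
          * ‖tipDeriv hs γ (stepOf z)‖ ^ (1 : ℝ)
          * inner ℝ (baseDeriv hs γ (stepOf z)) (taylorQuot s (contDeriv hs γ) z) ^ 2 := by
  have h1 := hc (stepOf z)
  rw [stepOf_fst, fst_add_stepOf] at h1
  have h2 := abs_stepOf_snd z
  rw [tipDeriv_apply, baseDeriv_apply, stepOf_fst, fst_add_stepOf, h1, Real.rpow_two,
    Real.rpow_one, Real.rpow_one]
  set V := contDeriv hs γ with hV
  set Q := diffQuot hs γ (stepOf z) with hQ
  set h : ℝ := ((stepOf z).2 : ℝ)
  set T := taylorQuot s V z with hT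
  have hτ : V z.1 ≠ 0 := by rw [hV, ← diffQuot_zeroStep]; exact hγ _
  have hτ' : ‖V z.1‖ ≠ 0 := norm_ne_zero_iff.2 hτ
  have hQ0 : 0 < ‖Q‖ := norm_pos_iff.2 (hγ _)
  have hTdef : T = (|h| ^ (s + 1 / 2))⁻¹ • (h • (Q - V z.1)) := by rw [hT, taylorQuot, ← h2]; rfl
  rcases eq_or_ne h 0 with h0 | h0
  -- on the diagonal the left side is `0 / 0 = 0` and the remainder quotient is `0`
  · have hT0 : T = 0 := by rw [hTdef, h0, zero_smul, smul_zero]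
    have hP0 : normalProj (V z.1) 0 = 0 := map_zero _
    simp [hT0, h0, hP0]
  have hpos : 0 < |h| := abs_pos.2 h0
  have hr : 0 < |h| ^ (s + 1 / 2) := Real.rpow_pos_of_pos hpos _
  have h3 : normalProj (V z.1) (h • Q) = |h| ^ (s + 1 / 2) • normalProj (V z.1) T := by
    rw [hTdef, normalProj_smul, normalProj_smul, normalProj_smul, normalProj_sub_self,
      smul_inv_smul₀ hr.ne']
  have h4 : (|h| ^ (s + 1 / 2)) ^ 2 = |h| ^ p := by
    rw [← Real.rpow_natCast, ← Real.rpow_mul hpos.le]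
    congr 1
    push_cast
    linarith
  have h5 : 0 < |h| ^ p := Real.rpow_pos_of_pos hpos _
  have h6 : 0 < ‖Q‖ ^ p := Real.rpow_pos_of_pos hQ0 _
  rw [h3, norm_smul, norm_smul, mul_pow, norm_normalProj_sq hτ, Real.norm_of_nonneg hr.le,
    Real.norm_eq_abs, h4, Real.mul_rpow hpos.le hQ0.le, Real.rpow_neg hQ0.le,
    Real.rpow_neg_one]
  field_simp

/-- The energy of an injective regular curve as a combination of two weighted square integrals of
the Taylor remainder quotient. -/
lemma energy_eq {p : ℝ} (hp : s = (p - 1) / 2) (hs : 3 / 2 < s) {γ : Sobolev s n}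
    (hγ : ∀ k, diffQuot hs γ k ≠ 0) {A B : C(StepSpace, ℝ)}
    (hA : ∀ k, A k = ‖diffQuot hs γ k‖ ^ (-p) * ‖baseDeriv hs γ k‖ ^ (1 : ℝ)
      * ‖tipDeriv hs γ k‖ ^ (1 : ℝ))
    (hB : ∀ k, B k = ‖diffQuot hs γ k‖ ^ (-p) * ‖baseDeriv hs γ k‖ ^ (-1 : ℝ)
      * ‖tipDeriv hs γ k‖ ^ (1 : ℝ)) :
    γ.energy p 2 ≠ ⊤ ∧ (γ.energy p 2).toReal = weightedSq A (taylor hs γ)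
      - weightedSq B (innerMul n (baseDeriv hs γ) (taylor hs γ)) := by
  obtain ⟨c, hγc, hc1, -, hc⟩ := exists_classical hs γ
  have hV := weakDeriv_ae_eq hs γ
  set V := contDeriv hs γ
  set f : Circ × Circ → ℝ := fun z => ‖normalProj (V z.1) (c z.2 - c z.1)‖ ^ (2 : ℝ)
    / ‖c z.2 - c z.1‖ ^ p * ‖V z.1‖ * ‖V z.2‖
  have hf0 : ∀ z, 0 ≤ f z := fun z => by positivity
  have hfae : f =ᵐ[volume] fun z => A (stepOf z) * ‖taylor hs γ z‖ ^ 2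
      - B (stepOf z) * ‖innerMul n (baseDeriv hs γ) (taylor hs γ) z‖ ^ 2 := by
    filter_upwards [taylor_ae_eq hs γ, innerMul_ae_eq (baseDeriv hs γ) (taylor hs γ)]
      with z h1 h2
    rw [h2, h1, Real.norm_eq_abs, sq_abs, hA, hB]
    exact energy_integrand_eq hp hs hγ hc z
  have hIA := integrable_weightedSq A (taylor hs γ)
  have hIB := integrable_weightedSq B (innerMul n (baseDeriv hs γ) (taylor hs γ))
  have hfi : Integrable f := (hIA.sub hIB).congr hfae.symm
  have hE : γ.energy p 2 = ENNReal.ofReal (∫ z, f z) := by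
    rw [ofReal_integral_eq_lintegral_ofReal hfi (ae_of_all _ hf0), Measure.volume_eq_prod,
      lintegral_prod _ (by
        rw [← Measure.volume_eq_prod]
        exact hfi.aemeasurable.ennreal_ofReal)]
    refine lintegral_congr_ae ?_
    filter_upwards [hγc, hV] with x hx1 hx2
    refine lintegral_congr_ae ?_
    filter_upwards [hγc, hV] with y hy1 hy2
    rw [hx1, hx2, hy1, hy2]
  refine ⟨hE ▸ ENNReal.ofReal_ne_top, ?_⟩
  rw [hE, ENNReal.toReal_ofReal (integral_nonneg hf0), weightedSq_eq_integral,
    weightedSq_eq_integral, ← integral_sub hIA hIB]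
  exact integral_congr_ae hfae

/-- Near an injective regular curve the weights in the formula for the energy, `α = 1` and `α = -1`,
depend analytically on the curve. -/
lemma exists_analyticAt_weight (hs : 3 / 2 < s) (p α : ℝ) {γ₀ : Sobolev s n}
    (h₀ : ∀ k, diffQuot hs γ₀ k ≠ 0) :
    ∃ A : Sobolev s n → C(StepSpace, ℝ), AnalyticAt ℝ A γ₀ ∧ ∀ᶠ γ in 𝓝 γ₀, ∀ k,
      A γ k = ‖diffQuot hs γ k‖ ^ (-p) * ‖baseDeriv hs γ k‖ ^ α * ‖tipDeriv hs γ k‖ ^ (1 : ℝ) := by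
  have : Nonempty StepSpace := ⟨zeroStep 0⟩
  have hV : ∀ x, contDeriv hs γ₀ x ≠ 0 := fun x => by rw [← diffQuot_zeroStep]; exact h₀ _
  obtain ⟨Φ₁, ha₁, he₁⟩ := exists_analyticAt_norm_rpow (diffQuot hs) (-p) h₀
  obtain ⟨Φ₂, ha₂, he₂⟩ := exists_analyticAt_norm_rpow (baseDeriv hs) α (γ₀ := γ₀) fun k => hV _
  obtain ⟨Φ₃, ha₃, he₃⟩ := exists_analyticAt_norm_rpow (tipDeriv hs) 1 (γ₀ := γ₀) fun k => hV _
  refine ⟨fun γ => Φ₁ γ * Φ₂ γ * Φ₃ γ, (ha₁.mul ha₂).mul ha₃, ?_⟩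
  filter_upwards [he₁, he₂, he₃] with γ h1 h2 h3 k
  rw [ContinuousMap.mul_apply, ContinuousMap.mul_apply, h1, h2, h3]

/-- On the open set of injective regular curves the energy is finite, and near each of them it is a
composition of bounded bilinear maps with the analytic weights. -/
lemma energy_ne_top_and_analyticAt {p : ℝ} (hp : s = (p - 1) / 2) (hs : 3 / 2 < s)
    {γ₀ : Sobolev s n} (h₀ : γ₀ ∈ injectiveRegular s n) :
    γ₀.energy p 2 ≠ ⊤ ∧ AnalyticAt ℝ (fun γ : Sobolev s n => (γ.energy p 2).toReal) γ₀ := by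
  have h₀' := (isInjectiveRegular_iff hs γ₀).1 h₀
  obtain ⟨A, hA, hAe⟩ := exists_analyticAt_weight hs p 1 h₀'
  obtain ⟨B, hB, hBe⟩ := exists_analyticAt_weight hs p (-1) h₀'
  refine ⟨(energy_eq hp hs h₀' hAe.self_of_nhds hBe.self_of_nhds).1, ?_⟩
  have hT : AnalyticAt ℝ (taylor hs : Sobolev s n → LTwoProd n) γ₀ := (taylor hs).analyticAt γ₀
  have hI : AnalyticAt ℝ (fun γ => innerMul n (baseDeriv hs γ) (taylor hs γ)) γ₀ :=
    ((innerMul n).analyticAt_bilinear (baseDeriv hs γ₀, taylor hs γ₀)).comp₂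
      ((baseDeriv hs).analyticAt γ₀) hT
  refine ((analyticAt_weightedSq hA hT).sub (analyticAt_weightedSq hB hI)).congr ?_
  filter_upwards [hAe, hBe, (isOpen_injectiveRegular hs).mem_nhds h₀] with γ h1 h2 h3
  exact (energy_eq hp hs ((isInjectiveRegular_iff hs γ).1 h3) h1 h2).2.symm

end Sobolev

end

end TangentPoint

theorem mainTheorem3 (n : ℕ) (p s : ℝ) (hs : s = (p - 1) / 2) (hs₁ : 3 / 2 < s) (hs₂ : s < 2) :
    IsOpen (TangentPoint.Sobolev.injectiveRegular s n) ∧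
    (∀ γ ∈ TangentPoint.Sobolev.injectiveRegular s n, γ.energy p 2 ≠ ⊤) ∧
    AnalyticOnNhd ℝ (fun γ : TangentPoint.Sobolev s n => (γ.energy p 2).toReal)
      (TangentPoint.Sobolev.injectiveRegular s n) :=
  ⟨TangentPoint.Sobolev.isOpen_injectiveRegular hs₁,
    fun _ hγ => (TangentPoint.Sobolev.energy_ne_top_and_analyticAt hs hs₁ hγ).1,
    fun _ hγ => (TangentPoint.Sobolev.energy_ne_top_and_analyticAt hs hs₁ hγ).2⟩
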